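/- Let $\mathcal R$ be a unital commutative ring. For an $\mathcal R$-module $\mathcal M$ let $\mathcal M_{\rm nc}=\coprod_{n\ge 1}\mathcal M^{n\times n}$; matrices over $\mathcal R$ act on matrices over $\mathcal M$ from both sides by matrix multiplication. A subset $\Omega\subseteq\mathcal M_{\rm nc}$ is an nc set if it is closed under direct sums $X\oplus Y$. For an $\mathcal R$-module $\mathcal N$, a map $f\colon\Omega\to\mathcal N_{\rm nc}$ which preserves the size of matrices is an nc function if $f(X\oplus Y)=f(X)\oplus f(Y)$ for all $X,Y\in\Omega$, and $f(SXS^{-1})=Sf(X)S^{-1}$ whenever $X\in\Omega$, $S$ is an invertible matrix over $\mathcal R$ of the same size, and $SXS^{-1}\in\Omega$. If $\Omega$ is right admissible, that is, if for all $X\in\Omega$ of size $n$, $Y\in\Omega$ of size $m$ and $Z\in\mathcal M^{n\times m}$ there is an invertible $r\in\mathcal R$ with $\left[\begin{smallmatrix}X&rZ\\0&Y\end{smallmatrix}\right]\in\Omega$, then $\Delta_Rf(X,Y)(Z)$ denotes $r^{-1}$ times the $(1,2)$ block of $f\left(\left[\begin{smallmatrix}X&rZ\\0&Y\end{smallmatrix}\right]\right)$,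 which does not depend on $r$. For $Y\in\mathcal M^{s\times s}$, $s\ge1$, a matrix $X\in\mathcal M^{sm\times sm}$ with $m\ge 1$ is nilpotent about $Y$ if there is $\kappa\ge 1$ such that $(X-Y^{(m)})^{\odot_s\ell}=0$ for all $\ell\ge\kappa$. Here $Y^{(m)}=I_m\otimes Y$ is the direct sum of $m$ copies of $Y$, and the powers are those of $X-Y^{(m)}$ regarded as an $m\times m$ matrix over the tensor algebra of the module $\mathcal M^{s\times s}$, with entries in degree one. The set of all matrices nilpotent about $Y$ (for all $m\ge1$) is denoted by ${\rm Nilp}(\mathcal M,Y)$; it is a right admissible nc set. A pair of matrices $(X,Y)$ of the same size over $\mathcal M$ and $\mathcal N$ is regarded as a matrix over $\mathcal M\times\mathcal N$. **Theorem (implicit nc function theorem, nilpotent matrices).** Let $\mathcal M,\mathcal N,\mathcal O$ be modules over $\mathcal R$, let $s\ge1$, $X^0\in\mathcal M^{s\times s}$, $Y^0\in\mathcal N^{s\times s}$, and let $F\colon{\rm Nilp}(\mathcal M\times\mathcal N,(X^0,Y^0))\to\mathcal O_{\rm nc}$ be an nc function such that $F(X^0,Y^0)=0$ and such that the linear mapping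 $\Delta_R^YF((X^0,Y^0),(X^0,Y^0))\colon\mathcal N^{s\times s}\to\mathcal O^{s\times s}$ is invertible, where $$\Delta_R^XF((X,Y),(X,Y))(Z):=\Delta_RF((X,Y),(X,Y))(Z,0),\qquad \Delta_R^YF((X,Y),(X,Y))(Z):=\Delta_RF((X,Y),(X,Y))(0,Z).$$ Then: I. There exists an nc function $f\colon{\rm Nilp}(\mathcal M,X^0)\to{\rm Nilp}(\mathcal N,Y^0)$ such that (a) $X\in{\rm Nilp}(\mathcal M,X^0)\iff(X,f(X))\in{\rm Nilp}(\mathcal M\times\mathcal N,(X^0,Y^0))$; (b) for all $(X,Y)\in{\rm Nilp}(\mathcal M\times\mathcal N,(X^0,Y^0))$: $F(X,Y)=0\iff Y=f(X)$. Moreover, $f$ is the only nc function on ${\rm Nilp}(\mathcal M,X^0)$ with values in $\mathcal N_{\rm nc}$ that has property (b). II. For every $X\in{\rm Nilp}(\mathcal M,X^0)$, say of size $n$, the mapping $\Delta_R^YF((X,f(X)),(X,f(X)))\colon\mathcal N^{n\times n}\to\mathcal O^{n\times n}$ is linear and invertible, and for every $Z\in\mathcal M^{n\times n}$ $$\Delta_Rf(X,X)(Z)=-\Big(\Delta_R^YF((X,f(X)),(X,f(X)))\Big)^{-1}\Big(\Delta_R^XF((X,f(X)),(X,f(X)))(Z)\Big).$$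 -/

import Mathlib

/-! Noncommutative (nc) functions over modules, the right nc difference-differential operator,
and matrices nilpotent about a given matrix. -/

namespace NCImplicit

section Basic

/-- A subset of the nc space `∐ n, Mⁿˣⁿ`, given by its set of matrices of each size. -/
abbrev GradedSet (M : Type*) := (n : ℕ) → Set (Matrix (Fin n) (Fin n) M)

/-- A map between nc spaces which preserves the size of a matrix. Such a map is used as a function
on a graded set `Ω`; its values outside of `Ω` are irrelevant. -/
abbrev GradedMap (M N : Type*) :=
  (n : ℕ) → Matrix (Fin n) (Fin n) M → Matrix (Fin n) (Fin n) N

/-- The product `T X` of a scalar matrix and a matrix over a module. -/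
def lmul {R M : Type*} [CommRing R] [AddCommGroup M] [Module R M] {r p q : ℕ}
    (T : Matrix (Fin r) (Fin p) R) (X : Matrix (Fin p) (Fin q) M) : Matrix (Fin r) (Fin q) M :=
  Matrix.of fun i j => ∑ k, T i k • X k j

/-- The product `X S` of a matrix over a module and a scalar matrix. -/
def rmul {R M : Type*} [CommRing R] [AddCommGroup M] [Module R M] {p q r : ℕ}
    (X : Matrix (Fin p) (Fin q) M) (S : Matrix (Fin q) (Fin r) R) : Matrix (Fin p) (Fin r) M :=
  Matrix.of fun i j => ∑ k, S k j • X i k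

/-- The matrix `S X S⁻¹` for an invertible scalar matrix `S`. -/
def conj {R M : Type*} [CommRing R] [AddCommGroup M] [Module R M] {n : ℕ}
    (S : (Matrix (Fin n) (Fin n) R)ˣ) (X : Matrix (Fin n) (Fin n) M) :
    Matrix (Fin n) (Fin n) M :=
  rmul (lmul (S : Matrix (Fin n) (Fin n) R) X) ((S⁻¹ : (Matrix (Fin n) (Fin n) R)ˣ) :
    Matrix (Fin n) (Fin n) R)

/-- The block upper triangular matrix `[X, Z; 0, Y]`. -/
def blockUpper {M : Type*} [Zero M] {n m : ℕ} (X : Matrix (Fin n) (Fin n) M)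
    (Z : Matrix (Fin n) (Fin m) M) (Y : Matrix (Fin m) (Fin m) M) :
    Matrix (Fin (n + m)) (Fin (n + m)) M :=
  (Matrix.fromBlocks X Z 0 Y).reindex finSumFinEquiv finSumFinEquiv

/-- The direct sum `X ⊕ Y = [X, 0; 0, Y]`. -/
def directSum {M : Type*} [Zero M] {n m : ℕ} (X : Matrix (Fin n) (Fin n) M)
    (Y : Matrix (Fin m) (Fin m) M) : Matrix (Fin (n + m)) (Fin (n + m)) M :=
  blockUpper X 0 Y

/-- The `(1, 2)` block, of size `n × m`, of a matrix of size `n + m`. -/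
def block12 {M : Type*} {n m : ℕ} (W : Matrix (Fin (n + m)) (Fin (n + m)) M) :
    Matrix (Fin n) (Fin m) M :=
  Matrix.of fun i j => W (Fin.castAdd m i) (Fin.natAdd n j)

/-- A nc set: a set of square matrices of positive sizes which is closed under direct sums. -/
structure IsNCSet {M : Type*} [Zero M] (Ω : GradedSet M) : Prop where
  zero_empty : Ω 0 = ∅
  directSum_mem : ∀ {n m : ℕ} (X : Matrix (Fin n) (Fin n) M) (Y : Matrix (Fin m) (Fin m) M),
    X ∈ Ω n → Y ∈ Ω m → directSum X Y ∈ Ω (n + m)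

/-- `f` is a nc function on `Ω`: it respects direct sums and similarities. -/
structure IsNCFunctionOn (R : Type*) {M N : Type*} [CommRing R] [AddCommGroup M] [Module R M]
    [AddCommGroup N] [Module R N] (Ω : GradedSet M) (f : GradedMap M N) : Prop where
  map_directSum : ∀ {n m : ℕ} (X : Matrix (Fin n) (Fin n) M) (Y : Matrix (Fin m) (Fin m) M),
    X ∈ Ω n → Y ∈ Ω m → f (n + m) (directSum X Y) = directSum (f n X) (f m Y)
  map_conj : ∀ {n : ℕ} (X : Matrix (Fin n) (Fin n) M) (S : (Matrix (Fin n) (Fin n) R)ˣ),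
    X ∈ Ω n → conj S X ∈ Ω n → f n (conj S X) = conj S (f n X)

/-- A right admissible set: every `[X, r Z; 0, Y]` with `X, Y` in the set lies in the set for some
invertible scalar `r`. -/
def IsRightAdmissible (R : Type*) {M : Type*} [CommRing R] [AddCommGroup M] [Module R M]
    (Ω : GradedSet M) : Prop :=
  ∀ {n m : ℕ} (X : Matrix (Fin n) (Fin n) M) (Y : Matrix (Fin m) (Fin m) M)
    (Z : Matrix (Fin n) (Fin m) M), X ∈ Ω n → Y ∈ Ω m →
    ∃ r : Rˣ, blockUpper X ((r : R) • Z) Y ∈ Ω (n + m)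

open Classical in
/-- The right nc difference-differential operator on a right admissible set `Ω`:
`Δ_R f(X, Y)(Z)` is `r⁻¹` times the `(1, 2)` block of `f([X, r Z; 0, Y])`, for an invertible
scalar `r` such that `[X, r Z; 0, Y]` is in `Ω` (the result does not depend on `r`, see
`deltaR_eq`). -/
noncomputable def deltaR (R : Type*) {M N : Type*} [CommRing R] [AddCommGroup M] [Module R M]
    [AddCommGroup N] [Module R N] (Ω : GradedSet M) (f : GradedMap M N) {n m : ℕ}
    (X : Matrix (Fin n) (Fin n) M) (Y : Matrix (Fin m) (Fin m) M)
    (Z : Matrix (Fin n) (Fin m) M) : Matrix (Fin n) (Fin m) N :=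
  if h : ∃ r : Rˣ, blockUpper X ((r : R) • Z) Y ∈ Ω (n + m) then
    ((h.choose⁻¹ : Rˣ) : R) • block12 (f (n + m) (blockUpper X ((h.choose : R) • Z) Y))
  else 0

end Basic

section Nilpotent

/-- The matrix `Y⁽ᵐ⁾ = I_m ⊗ Y`, the direct sum of `m` copies of `Y`. -/
def ampliation {M : Type*} [Zero M] {s : ℕ} (Y : Matrix (Fin s) (Fin s) M) (m : ℕ) :
    Matrix (Fin (m * s)) (Fin (m * s)) M :=
  Matrix.of fun p q =>
    if (finProdFinEquiv.symm p).1 = (finProdFinEquiv.symm q).1 then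
      Y (finProdFinEquiv.symm p).2 (finProdFinEquiv.symm q).2
    else 0

/-- The identification of a matrix of size `m s` over `M` with a matrix of size `m` over the
module of matrices of size `s` over `M`. -/
def toSBlocks {M : Type*} {m s : ℕ} (X : Matrix (Fin (m * s)) (Fin (m * s)) M) :
    Matrix (Fin m) (Fin m) (Matrix (Fin s) (Fin s) M) :=
  Matrix.of fun i j => Matrix.of fun a b => X (finProdFinEquiv (i, a)) (finProdFinEquiv (j, b))

/-- A matrix of size `m s` over `M` as a matrix of size `m` over the tensor algebra of `Mˢˣˢ`.
The product of such matrices is the product `⊙ₛ`. -/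
def tensorMatrix (R : Type*) {M : Type*} [CommRing R] [AddCommGroup M] [Module R M] {m s : ℕ}
    (X : Matrix (Fin (m * s)) (Fin (m * s)) M) :
    Matrix (Fin m) (Fin m) (TensorAlgebra R (Matrix (Fin s) (Fin s) M)) :=
  (toSBlocks X).map (TensorAlgebra.ι R)

/-- The matrices of size `m s` which are nilpotent about `Y` of rank at most `κ`. -/
def NilpRank (R : Type*) {M : Type*} [CommRing R] [AddCommGroup M] [Module R M] {s : ℕ}
    (Y : Matrix (Fin s) (Fin s) M) (m κ : ℕ) : Set (Matrix (Fin (m * s)) (Fin (m * s)) M) :=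
  {X | ∀ l : ℕ, κ ≤ l → tensorMatrix R (X - ampliation Y m) ^ l = 0}

/-- The set of all matrices which are nilpotent about `Y`. Their sizes are the positive multiples
`m s` of the size `s` of `Y`. -/
def Nilp (R : Type*) {M : Type*} [CommRing R] [AddCommGroup M] [Module R M] {s : ℕ}
    (Y : Matrix (Fin s) (Fin s) M) : GradedSet M :=
  fun n => {X | ∃ (m κ : ℕ) (h : m * s = n), 1 ≤ m ∧ 1 ≤ κ ∧
    X.submatrix (Fin.cast h) (Fin.cast h) ∈ NilpRank R Y m κ}

end Nilpotent

section Pairs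

/-- A pair of matrices as a matrix over the product module. -/
def pair {M N : Type*} {n m : ℕ} (X : Matrix (Fin n) (Fin m) M) (Y : Matrix (Fin n) (Fin m) N) :
    Matrix (Fin n) (Fin m) (M × N) :=
  Matrix.of fun i j => (X i j, Y i j)

/-- `Δ_R^X F((X, Y), (X, Y))(Z) = Δ_R F((X, Y), (X, Y))(Z, 0)`. -/
noncomputable def deltaRX (R : Type*) {M N O : Type*} [CommRing R] [AddCommGroup M] [Module R M]
    [AddCommGroup N] [Module R N] [AddCommGroup O] [Module R O] (Ω : GradedSet (M × N))
    (F : GradedMap (M × N) O) {n : ℕ}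
    (X : Matrix (Fin n) (Fin n) M) (Y : Matrix (Fin n) (Fin n) N)
    (Z : Matrix (Fin n) (Fin n) M) : Matrix (Fin n) (Fin n) O :=
  deltaR R Ω F (pair X Y) (pair X Y) (pair Z 0)

/-- `Δ_R^Y F((X, Y), (X, Y))(Z) = Δ_R F((X, Y), (X, Y))(0, Z)`. -/
noncomputable def deltaRY (R : Type*) {M N O : Type*} [CommRing R] [AddCommGroup M] [Module R M]
    [AddCommGroup N] [Module R N] [AddCommGroup O] [Module R O] (Ω : GradedSet (M × N))
    (F : GradedMap (M × N) O) {n : ℕ}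
    (X : Matrix (Fin n) (Fin n) M) (Y : Matrix (Fin n) (Fin n) N)
    (Z : Matrix (Fin n) (Fin n) N) : Matrix (Fin n) (Fin n) O :=
  deltaR R Ω F (pair X Y) (pair X Y) (pair 0 Z)

end Pairs

section Facts

variable {R M N : Type*} [CommRing R] [AddCommGroup M] [Module R M] [AddCommGroup N] [Module R N]

theorem tensorMatrix_blockUpper {s m₁ m₂ : ℕ} (h : (m₁ + m₂) * s = m₁ * s + m₂ * s)
    (Y : Matrix (Fin s) (Fin s) M)
    (X₁ : Matrix (Fin (m₁ * s)) (Fin (m₁ * s)) M) (X₂ : Matrix (Fin (m₂ * s)) (Fin (m₂ * s)) M)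
    (Z : Matrix (Fin (m₁ * s)) (Fin (m₂ * s)) M) :
    ∃ C, tensorMatrix R ((blockUpper X₁ Z X₂).submatrix (Fin.cast h) (Fin.cast h) -
        ampliation Y (m₁ + m₂)) =
      Matrix.reindexAlgEquiv R _ finSumFinEquiv (Matrix.fromBlocks
        (tensorMatrix R (X₁ - ampliation Y m₁)) C 0 (tensorMatrix R (X₂ - ampliation Y m₂))) := by
  have e1 : ∀ (i : Fin m₁) (a : Fin s), Fin.cast h (finProdFinEquiv (Fin.castAdd m₂ i, a)) =
      Fin.castAdd (m₂ * s) (finProdFinEquiv (i, a)) := by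
    intro i a; ext; simp [finProdFinEquiv]
  have e2 : ∀ (i : Fin m₂) (a : Fin s), Fin.cast h (finProdFinEquiv (Fin.natAdd m₁ i, a)) =
      Fin.natAdd (m₁ * s) (finProdFinEquiv (i, a)) := by
    intro i a; ext; simp [finProdFinEquiv]; ring
  refine ⟨Matrix.of fun i j => TensorAlgebra.ι R (Matrix.of fun a b =>
    Z (finProdFinEquiv (i, a)) (finProdFinEquiv (j, b))), ?_⟩
  ext i j
  obtain ⟨i, rfl⟩ := finSumFinEquiv.surjective i
  obtain ⟨j, rfl⟩ := finSumFinEquiv.surjective j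
  rcases i with i | i <;> rcases j with j | j
  · simp only [tensorMatrix, toSBlocks, ampliation, blockUpper, Matrix.map_apply, Matrix.of_apply,
      Matrix.coe_reindexAlgEquiv, Matrix.reindex_apply, Matrix.submatrix_apply, Matrix.sub_apply,
      finSumFinEquiv_apply_left, e1, finSumFinEquiv_symm_apply_castAdd, Equiv.symm_apply_apply,
      Matrix.fromBlocks_apply₁₁, Fin.castAdd_inj]
  · have hne : Fin.castAdd m₂ i ≠ Fin.natAdd m₁ j := by
      intro hh; have := congrArg Fin.val hh; simp at this; omega
    simp only [tensorMatrix, toSBlocks, ampliation, blockUpper, Matrix.map_apply, Matrix.of_apply,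
      Matrix.coe_reindexAlgEquiv, Matrix.reindex_apply, Matrix.submatrix_apply, Matrix.sub_apply,
      finSumFinEquiv_apply_left, finSumFinEquiv_apply_right, e1, e2,
      finSumFinEquiv_symm_apply_castAdd, finSumFinEquiv_symm_apply_natAdd, Equiv.symm_apply_apply,
      Matrix.fromBlocks_apply₁₂, hne, if_false, sub_zero]
  · have hne : Fin.natAdd m₁ i ≠ Fin.castAdd m₂ j := by
      intro hh; have := congrArg Fin.val hh; simp at this; omega
    simp only [tensorMatrix, toSBlocks, ampliation, blockUpper, Matrix.map_apply, Matrix.of_apply,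
      Matrix.coe_reindexAlgEquiv, Matrix.reindex_apply, Matrix.submatrix_apply, Matrix.sub_apply,
      finSumFinEquiv_apply_left, finSumFinEquiv_apply_right, e1, e2,
      finSumFinEquiv_symm_apply_castAdd, finSumFinEquiv_symm_apply_natAdd, Equiv.symm_apply_apply,
      Matrix.fromBlocks_apply₂₁, hne, if_false, sub_zero, Matrix.zero_apply]
    exact map_zero _
  · simp only [tensorMatrix, toSBlocks, ampliation, blockUpper, Matrix.map_apply, Matrix.of_apply,
      Matrix.coe_reindexAlgEquiv, Matrix.reindex_apply, Matrix.submatrix_apply, Matrix.sub_apply,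
      finSumFinEquiv_apply_right, e2, finSumFinEquiv_symm_apply_natAdd, Equiv.symm_apply_apply,
      Matrix.fromBlocks_apply₂₂, Fin.natAdd_inj]

theorem fromBlocks_upper_pow {A : Type*} [Semiring A] {m₁ m₂ : ℕ}
    (P : Matrix (Fin m₁) (Fin m₁) A) (C : Matrix (Fin m₁) (Fin m₂) A)
    (Q : Matrix (Fin m₂) (Fin m₂) A) (k : ℕ) :
    ∃ D, Matrix.fromBlocks P C 0 Q ^ k = Matrix.fromBlocks (P ^ k) D 0 (Q ^ k) := by
  induction k with
  | zero => exact ⟨0, by simp [Matrix.fromBlocks_one]⟩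
  | succ k ih =>
    obtain ⟨D, hD⟩ := ih
    exact ⟨_, by rw [pow_succ, hD, Matrix.fromBlocks_multiply]; simp [pow_succ]; rfl⟩

/-- In the set of matrices nilpotent about a given matrix, every scalar `r` is admissible. -/
theorem blockUpper_mem_nilp {s n m : ℕ} (Y : Matrix (Fin s) (Fin s) M)
    (X₁ : Matrix (Fin n) (Fin n) M) (X₂ : Matrix (Fin m) (Fin m) M)
    (Z : Matrix (Fin n) (Fin m) M) (h₁ : X₁ ∈ Nilp R Y n) (h₂ : X₂ ∈ Nilp R Y m) :
    blockUpper X₁ Z X₂ ∈ Nilp R Y (n + m) := by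
  obtain ⟨m₁, k₁, rfl, hm₁, hk₁, H₁⟩ := h₁
  obtain ⟨m₂, k₂, rfl, hm₂, hk₂, H₂⟩ := h₂
  refine ⟨m₁ + m₂, k₁ + k₂, by ring, by omega, by omega, ?_⟩
  have H₁' : tensorMatrix R (X₁ - ampliation Y m₁) ^ k₁ = 0 := H₁ k₁ le_rfl
  have H₂' : tensorMatrix R (X₂ - ampliation Y m₂) ^ k₂ = 0 := H₂ k₂ le_rfl
  intro l hl
  obtain ⟨C, hC⟩ := tensorMatrix_blockUpper (R := R) (by ring) Y X₁ X₂ Z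
  rw [hC]
  have key : ∀ (P : Matrix (Fin m₁) (Fin m₁) (TensorAlgebra R (Matrix (Fin s) (Fin s) M)))
      (Q : Matrix (Fin m₂) (Fin m₂) (TensorAlgebra R (Matrix (Fin s) (Fin s) M))), P ^ k₁ = 0 → Q ^ k₂ = 0 →
      (Matrix.fromBlocks P C 0 Q) ^ (k₁ + k₂) = 0 := by
    intro P Q hP hQ
    obtain ⟨D, hD⟩ := fromBlocks_upper_pow P C Q k₁
    obtain ⟨E, hE⟩ := fromBlocks_upper_pow P C Q k₂
    rw [pow_add, hD, hE, Matrix.fromBlocks_multiply]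
    simp [hP, hQ]
  obtain ⟨t, rfl⟩ := Nat.exists_eq_add_of_le hl
  rw [pow_add, ← map_pow, key _ _ H₁' H₂', map_zero, zero_mul]

theorem isNCSet_nilp {s : ℕ} (hs : 1 ≤ s) (Y : Matrix (Fin s) (Fin s) M) :
    IsNCSet (Nilp R Y) where
  zero_empty := by
    ext X
    simp only [Set.mem_empty_iff_false, iff_false]
    rintro ⟨m, κ, h, hm, -⟩
    have := Nat.mul_pos hm hs
    omega
  directSum_mem X₁ X₂ h₁ h₂ := blockUpper_mem_nilp Y X₁ X₂ 0 h₁ h₂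

theorem isRightAdmissible_nilp {s : ℕ} (Y : Matrix (Fin s) (Fin s) M) :
    IsRightAdmissible R (Nilp R Y) :=
  fun X₁ X₂ _ h₁ h₂ => ⟨1, blockUpper_mem_nilp Y X₁ X₂ _ h₁ h₂⟩

theorem center_mem_nilp {s : ℕ} (Y : Matrix (Fin s) (Fin s) M) : Y ∈ Nilp R Y s := by
  refine ⟨1, 1, one_mul s, le_rfl, le_rfl, ?_⟩
  intro l hl
  have : tensorMatrix R (Y.submatrix (Fin.cast (one_mul s)) (Fin.cast (one_mul s)) -
      ampliation Y 1) = 0 := by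
    ext i j
    have h0 : ∀ (i : Fin 1) (a : Fin s), Fin.cast (one_mul s) (finProdFinEquiv (i, a)) = a := by
      intro i a; ext; simp [finProdFinEquiv]
    have hij : i = j := Subsingleton.elim _ _
    simp only [tensorMatrix, toSBlocks, ampliation, Matrix.map_apply, Matrix.of_apply,
      Matrix.submatrix_apply, Matrix.sub_apply, h0, Equiv.symm_apply_apply, hij, if_true, sub_self,
      Matrix.zero_apply]
    exact map_zero _
  rw [this, zero_pow (by omega)]

/-- The invertible diagonal matrix with given invertible diagonal entries. -/
def diagUnit {n : ℕ} (d : Fin n → Rˣ) : (Matrix (Fin n) (Fin n) R)ˣ where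
  val := Matrix.diagonal fun i => (d i : R)
  inv := Matrix.diagonal fun i => (((d i)⁻¹ : Rˣ) : R)
  val_inv := by simp [Matrix.diagonal_mul_diagonal]
  inv_val := by simp [Matrix.diagonal_mul_diagonal]

theorem conj_diagUnit {n : ℕ} (d : Fin n → Rˣ) (W : Matrix (Fin n) (Fin n) M) (i j : Fin n) :
    conj (diagUnit d) W i j = ((((d j)⁻¹ : Rˣ) : R) * (d i : R)) • W i j := by
  have hv : (diagUnit d : Matrix (Fin n) (Fin n) R) = Matrix.diagonal fun i => (d i : R) := rfl
  have hi : (((diagUnit d)⁻¹ : (Matrix (Fin n) (Fin n) R)ˣ) : Matrix (Fin n) (Fin n) R) =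
      Matrix.diagonal fun i => (((d i)⁻¹ : Rˣ) : R) := rfl
  simp only [conj, rmul, lmul, hv, hi, Matrix.of_apply, Matrix.diagonal_apply, ite_smul,
    zero_smul, Finset.sum_ite_eq, Finset.sum_ite_eq', Finset.mem_univ, if_true, mul_smul]

/-- The value `Δ_R f(X, Y)(Z)` does not depend on the choice of the invertible scalar `r`. -/
theorem deltaR_eq {Ω : GradedSet M} {f : GradedMap M N} (hf : IsNCFunctionOn R Ω f) {n m : ℕ}
    (X : Matrix (Fin n) (Fin n) M) (Y : Matrix (Fin m) (Fin m) M)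
    (Z : Matrix (Fin n) (Fin m) M) (r : Rˣ) (hr : blockUpper X ((r : R) • Z) Y ∈ Ω (n + m)) :
    deltaR R Ω f X Y Z =
      ((r⁻¹ : Rˣ) : R) • block12 (f (n + m) (blockUpper X ((r : R) • Z) Y)) := by
  have h : ∃ r : Rˣ, blockUpper X ((r : R) • Z) Y ∈ Ω (n + m) := ⟨r, hr⟩
  have ht := h.choose_spec
  rw [deltaR, dif_pos h]
  generalize h.choose = t at *
  obtain ⟨d, hd₁, hd₂⟩ : ∃ d : Fin (n + m) → Rˣ,
      (∀ i, d (Fin.castAdd m i) = r * t⁻¹) ∧ ∀ i, d (Fin.natAdd n i) = 1 :=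
    ⟨Fin.addCases (fun _ => r * t⁻¹) (fun _ => 1), by simp, by simp⟩
  have hc : conj (diagUnit d) (blockUpper X ((t : R) • Z) Y) = blockUpper X ((r : R) • Z) Y := by
    ext i j
    rw [conj_diagUnit]
    refine Fin.addCases (fun i => ?_) (fun i => ?_) i <;>
      refine Fin.addCases (fun j => ?_) (fun j => ?_) j <;>
      rw [← Units.val_mul] <;>
      simp only [hd₁, hd₂, inv_mul_cancel, Units.val_one, one_smul] <;>
      simp [blockUpper, smul_smul]
  have hk := hf.map_conj _ (diagUnit d) ht (by rw [hc]; exact hr)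
  rw [hc] at hk
  rw [hk]
  ext i j
  simp only [block12, Matrix.smul_apply, Matrix.of_apply]
  rw [conj_diagUnit, hd₁, hd₂, smul_smul]
  simp

end Facts

end NCImplicit

open NCImplicit

/-! The proof reduces the theorem to a statement about nilpotent matrices over one module and solves
the equation there by a Taylor expansion.

*Reduction.* A matrix nilpotent about `C` is a matrix of `s × s` blocks of the form `C⁽ᵐ⁾ + P`,
where `P` is a matrix over the module of blocks `W` whose image over the tensor algebra `T(W)` is
nilpotent (`mem_nilp_iff`). Of the nc function `F` only one property of `P ↦ F(C⁽ᵐ⁾ + P)` is used: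
if `P T = T Q` for a rectangular scalar matrix `T`, then the values are intertwined by `T` as well
(`IsNCFunctionOn.intertwines_atBlocks`).

*Taylor formula.* For such a function `Φ`, the difference quotients at `0` and `q` form a function
of `q` of the same kind, with values in matrices of linear maps on `W`
(`Intertwines.intertwines_quotient`). Iteration gives, for each `L`, a linear map `φ` on `T(W)` with
`Φ p = φ (1 + p + ⋯ + p ^ (L - 1))` entrywise whenever `p ^ L = 0` over `T(W)`
(`Intertwines.exists_taylor`); the remainder is linear in `p ^ L` and vanishes. This is where
nilpotency over the tensor algebra enters. No triangular form is available over a general ring.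

*Solving.* After composition with the inverse of `Δ_R^Y F` at the center, the equation reads
`q = -φ p - ∑ φ ((p + q) ^ l)`, summed over `l ≥ 2`. The right-hand side raises the order in `p` of
differences, so iteration from `q = 0` becomes stationary, at a `q` of positive order in `p`, and
then `p + q` is nilpotent (`Intertwines.exists_implicit`). By the same expansion
`Δ_R^Y F` at any two nilpotent matrices is, up to the isomorphism at the center, the sum of the
identity and a nilpotent operator, hence bijective (`Intertwines.existsUnique_upperRight`). Both
arguments rest on the fact that a product of linear images of homogeneous matrices is a linear image
of their product (`Homogeneous.exists_map_mul_map`).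

*Conclusion.* If `(X, Y)` and `(X', Y')` are zeros of `F` and `X T = T X'`, then conjugation of
`(X, Y) ⊕ (X', Y')` by `[1, T; 0, 1]` gives a zero of `F` with upper right block `(0, T Y' - Y T)`,
so injectivity of `Δ_R^Y F` gives `Y T = T Y'` (`intertwine_of_zero`). With `T = 1` this is
uniqueness of the solution, and with `T` invertible it is the invariance of `f` under similarities.
The formula for `Δ_R f` follows from the uniqueness of the solution at `[X, Z; 0, X]`. -/

namespace NCImplicit

/-! ### Linear maps on the tensor algebra -/

section TensorAlgebra

universe u w

open TensorAlgebra in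
/-- A linear map on the tensor algebra may be prescribed on `1` and, bilinearly, on all products
`w ⊗ x` with `w` of degree one: the tensor algebra is `R ⊕ W ⊗ T(W)`. -/
theorem exists_linearMap_ι_mul {R W E : Type*} [CommRing R] [AddCommGroup W] [Module R W]
    [AddCommGroup E] [Module R E] (c : E) (b : W →ₗ[R] TensorAlgebra R W →ₗ[R] E) :
    ∃ φ : TensorAlgebra R W →ₗ[R] E, φ 1 = c ∧ ∀ w x, φ (ι R w * x) = b w x := by
  -- Each letter acts on `T(W) × E` by `(t, e) ↦ (w ⊗ t, b w t)`, and then `x` sends `(1, c)` to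
  -- `(x, φ x)`.
  let g : W →ₗ[R] Module.End R (TensorAlgebra R W × E) :=
    { toFun := fun w => LinearMap.prod
        ((LinearMap.mulLeft R (ι R w)).comp (LinearMap.fst R _ _))
        ((b w).comp (LinearMap.fst R _ _))
      map_add' := fun v w => by ext <;> simp [add_mul]
      map_smul' := fun r w => by ext <;> simp }
  have hfst : ∀ x y, (lift R g x y).1 = x * y.1 := by
    intro x
    induction x using TensorAlgebra.induction with
    | algebraMap r => intro y; simp [Module.algebraMap_end_apply, Algebra.smul_def]
    | ι w => intro y; simp [g]
    | mul x y hx hy => intro z; simp [hx, hy, mul_assoc]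
    | add x y hx hy => intro z; simp [hx, hy, add_mul]
  refine ⟨(LinearMap.snd R _ _).comp ((LinearMap.applyₗ (1, c)).comp (lift R g).toLinearMap),
    by simp, fun w x => ?_⟩
  have h := hfst x (1, c)
  simp [g, h]

/-- A bilinear map on the tensor algebra factors through the product once its first argument is
homogeneous of a fixed degree. -/
theorem exists_linearMap_mul {R : Type u} {W : Type w} [CommRing R] [AddCommGroup W] [Module R W]
    (a : ℕ) {E : Type (max u w)} [AddCommGroup E] [Module R E]
    (b : TensorAlgebra R W →ₗ[R] TensorAlgebra R W →ₗ[R] E) :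
    ∃ χ : TensorAlgebra R W →ₗ[R] E,
      ∀ x ∈ LinearMap.range (TensorAlgebra.ι R (M := W)) ^ a, ∀ y, χ (x * y) = b x y := by
  induction a generalizing E with
  | zero =>
    refine ⟨b 1, fun x hx y => ?_⟩
    rw [pow_zero, Submodule.mem_one] at hx
    obtain ⟨r, rfl⟩ := hx
    rw [Algebra.algebraMap_eq_smul_one, map_smul, smul_mul_assoc, one_mul, map_smul,
      LinearMap.smul_apply]
  | succ a ih =>
    let b' : TensorAlgebra R W →ₗ[R] TensorAlgebra R W →ₗ[R] (W →ₗ[R] E) :=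
      LinearMap.mk₂ R (fun x y =>
        (b.flip y).comp ((LinearMap.mulRight R x).comp (TensorAlgebra.ι R)))
        (fun _ _ _ => by ext; simp [mul_add]) (fun _ _ _ => by ext; simp)
        (fun _ _ _ => by ext; simp) (fun _ _ _ => by ext; simp)
    obtain ⟨χ', hχ'⟩ := ih b'
    obtain ⟨χ, -, hχ⟩ := exists_linearMap_ι_mul 0 χ'.flip
    refine ⟨χ, fun x hx y => ?_⟩
    rw [pow_succ'] at hx
    induction hx using Submodule.mul_induction_on' with
    | mem_mul_mem v hv x hx =>
      obtain ⟨w, rfl⟩ := hv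
      rw [mul_assoc, hχ, LinearMap.flip_apply, hχ' x hx]
      simp [b']
    | add x _ x' _ hx hx' => rw [add_mul, map_add, hx, hx', map_add, LinearMap.add_apply]

end TensorAlgebra

/-! ### Matrices over the tensor algebra -/

section Matrices

universe u w

variable {R : Type u} {W : Type w} [CommRing R] [AddCommGroup W] [Module R W]
variable {μ ν ξ : Type}

/-- All entries of the matrix are homogeneous of degree `a` in the tensor algebra. -/
def Homogeneous (a : ℕ) (x : Matrix μ ν (TensorAlgebra R W)) : Prop :=
  ∀ i j, x i j ∈ LinearMap.range (TensorAlgebra.ι R (M := W)) ^ a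

theorem homogeneous_map_ι (x : Matrix μ ν W) : Homogeneous 1 (x.map (TensorAlgebra.ι R)) := by
  intro i j
  rw [pow_one]
  exact LinearMap.mem_range_self _ _

theorem Homogeneous.mul [Fintype ν] {a b : ℕ} {x : Matrix μ ν (TensorAlgebra R W)}
    {y : Matrix ν ξ (TensorAlgebra R W)} (hx : Homogeneous a x) (hy : Homogeneous b y) :
    Homogeneous (a + b) (x * y) := by
  intro i j
  rw [Matrix.mul_apply, pow_add]
  exact Submodule.sum_mem _ fun k _ => Submodule.mul_mem_mul (hx i k) (hy k j)

theorem homogeneous_pow_map_ι [Fintype μ] [DecidableEq μ] (x : Matrix μ μ W) (a : ℕ) :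
    Homogeneous a (x.map (TensorAlgebra.ι R) ^ a) := by
  induction a with
  | zero =>
    intro i j
    rw [pow_zero, pow_zero, Matrix.one_apply]
    split_ifs
    · exact Submodule.one_le.mp le_rfl
    · exact Submodule.zero_mem _
  | succ a ih =>
    rw [pow_succ]
    exact ih.mul (homogeneous_map_ι x)

/-- The product of linear images of two matrices is a linear image of their product, when the first
one is homogeneous. -/
theorem Homogeneous.exists_map_mul_map [Fintype ν] {a : ℕ} {x : Matrix μ ν (TensorAlgebra R W)}
    (hx : Homogeneous a x) (y : Matrix ν ξ (TensorAlgebra R W))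
    (χ χ' : TensorAlgebra R W →ₗ[R] TensorAlgebra R W) :
    ∃ χ'' : TensorAlgebra R W →ₗ[R] TensorAlgebra R W,
      x.map χ * y.map χ' = (x * y).map χ'' := by
  obtain ⟨χ'', h⟩ := exists_linearMap_mul (R := R) a ((LinearMap.mul R _).compl₁₂ χ χ')
  refine ⟨χ'', ?_⟩
  ext i j
  simp only [Matrix.mul_apply, Matrix.map_apply, map_sum]
  refine Finset.sum_congr rfl fun k _ => ?_
  rw [h _ (hx i k)]
  simp

/-- Powers of a block upper triangular matrix. -/
theorem fromBlocks_pow {A : Type*} [Semiring A] [Fintype μ] [DecidableEq μ] [Fintype ν]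
    [DecidableEq ν] (P : Matrix μ μ A) (C : Matrix μ ν A) (Q : Matrix ν ν A) (n : ℕ) :
    Matrix.fromBlocks P C 0 Q ^ n = Matrix.fromBlocks (P ^ n)
      (∑ k ∈ Finset.range n, P ^ k * C * Q ^ (n - 1 - k)) 0 (Q ^ n) := by
  induction n with
  | zero => simp [Matrix.fromBlocks_one]
  | succ n ih =>
    rw [pow_succ', ih, Matrix.fromBlocks_multiply]
    congr 1
    · simp [pow_succ']
    · rw [Finset.sum_range_succ', Matrix.mul_sum]
      simp only [pow_zero, Matrix.one_mul, Nat.add_sub_cancel, Nat.sub_zero]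
      congr 1
      refine Finset.sum_congr rfl fun k hk => ?_
      rw [pow_succ', Nat.sub_sub, add_comm 1 k]
      simp only [Matrix.mul_assoc]
    · simp
    · simp [pow_succ']

end Matrices

/-! ### Nilpotent matrices over a module -/

section Nil

universe u w

variable {R : Type u} {W : Type w} [CommRing R] [AddCommGroup W] [Module R W]
variable {μ ν : Type}

theorem map_ι_injective : Function.Injective
    fun p : Matrix μ ν W => p.map (TensorAlgebra.ι R) := fun p q h => by
  ext i j
  exact TensorAlgebra.ι_leftInverse.injective (congrFun (congrFun h i) j)

theorem map_ι_fromBlocks (p : Matrix μ μ W) (b : Matrix μ ν W) (q : Matrix ν ν W) :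
    (Matrix.fromBlocks p b 0 q).map (TensorAlgebra.ι R) = Matrix.fromBlocks
      (p.map (TensorAlgebra.ι R)) (b.map (TensorAlgebra.ι R)) 0 (q.map (TensorAlgebra.ι R)) := by
  rw [Matrix.fromBlocks_map, Matrix.map_zero _ (map_zero _)]

variable [Fintype μ] [DecidableEq μ] [Fintype ν] [DecidableEq ν]

variable (R) in
/-- A square matrix over a module is nilpotent if it is nilpotent over the tensor algebra. -/
def Nil (p : Matrix μ μ W) : Prop := IsNilpotent (p.map (TensorAlgebra.ι R))

theorem map_ι_fromBlocks_pow_eq_zero {p : Matrix μ μ W} {b : Matrix μ ν W} {q : Matrix ν ν W}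
    {k l : ℕ} (hp : p.map (TensorAlgebra.ι R) ^ k = 0) (hq : q.map (TensorAlgebra.ι R) ^ l = 0) :
    (Matrix.fromBlocks p b 0 q).map (TensorAlgebra.ι R) ^ (k + l) = 0 := by
  rw [map_ι_fromBlocks, pow_add, fromBlocks_pow, fromBlocks_pow, hp, hq,
    Matrix.fromBlocks_multiply]
  simp

theorem Nil.fromBlocks {p : Matrix μ μ W} {q : Matrix ν ν W} (hp : Nil R p) (hq : Nil R q)
    (b : Matrix μ ν W) : Nil R (Matrix.fromBlocks p b 0 q) := by
  obtain ⟨k, hk⟩ := hp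
  obtain ⟨l, hl⟩ := hq
  exact ⟨k + l, map_ι_fromBlocks_pow_eq_zero hk hl⟩

theorem nil_zero : Nil R (0 : Matrix μ μ W) :=
  ⟨1, by rw [pow_one, Matrix.map_zero _ (map_zero _)]⟩

end Nil

/-! ### Functions of nilpotent matrices and their Taylor expansion -/

section Taylor

universe w

variable {R : Type*} {W : Type w} [CommRing R] [AddCommGroup W] [Module R W]

/-- A function defined on square matrices over `W`, with arbitrary finite index types, respects
intertwinings if `p T = T q` implies `Φ p T = T (Φ q)` for all nilpotent `p`, `q` and all scalar
matrices `T`, which may be rectangular. Its values at matrices that are not nilpotent are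
irrelevant. -/
def Intertwines (R : Type*) {W O : Type*} [CommRing R] [AddCommGroup W] [Module R W]
    [AddCommGroup O] [Module R O]
    (Φ : ∀ (μ : Type) [Fintype μ] [DecidableEq μ], Matrix μ μ W → Matrix μ μ O) : Prop :=
  ∀ (μ ν : Type) [Fintype μ] [DecidableEq μ] [Fintype ν] [DecidableEq ν]
    (p : Matrix μ μ W) (q : Matrix ν ν W) (T : Matrix μ ν R), Nil R p → Nil R q →
    (∀ i j, ∑ k, T k j • p i k = ∑ k, T i k • q k j) →
    ∀ i j, ∑ k, T k j • Φ μ p i k = ∑ k, T i k • Φ ν q k j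

variable {O : Type*} [AddCommGroup O] [Module R O]
variable {Φ : ∀ (μ : Type) [Fintype μ] [DecidableEq μ], Matrix μ μ W → Matrix μ μ O}
variable {α α' β β' : Type} [Fintype α] [DecidableEq α] [Fintype β] [DecidableEq β]
  [Fintype α'] [DecidableEq α'] [Fintype β'] [DecidableEq β']

theorem Intertwines.fromBlocks_inl_inl (hΦ : Intertwines R Φ) {A : Matrix α α W}
    {D : Matrix β β W} (hA : Nil R A) (hD : Nil R D) (B : Matrix α β W) (i j : α) :
    Φ (α ⊕ β) (Matrix.fromBlocks A B 0 D) (Sum.inl i) (Sum.inl j) = Φ α A i j := by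
  have h := hΦ (α ⊕ β) α (Matrix.fromBlocks A B 0 D) A (Matrix.fromRows 1 0) (hA.fromBlocks hD B) hA
    (by
      rintro (i | i) j <;>
        simp [Fintype.sum_sum_type, Matrix.one_apply, ite_smul]) (Sum.inl i) j
  simpa [Fintype.sum_sum_type, Matrix.one_apply, ite_smul] using h

/-- Naturality of the upper right block in both diagonal blocks. -/
theorem Intertwines.fromBlocks_inl_inr_natural (hΦ : Intertwines R Φ)
    {A : Matrix α α W} {D : Matrix β β W} {A' : Matrix α' α' W} {D' : Matrix β' β' W}
    (hA : Nil R A) (hD : Nil R D) (hA' : Nil R A') (hD' : Nil R D') (B : Matrix α β W)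
    (B' : Matrix α' β' W) (S : Matrix α α' R) (T : Matrix β β' R)
    (hS : ∀ i j, ∑ k, S k j • A i k = ∑ k, S i k • A' k j)
    (hT : ∀ i j, ∑ k, T k j • D i k = ∑ k, T i k • D' k j)
    (hB : ∀ i j, ∑ k, T k j • B i k = ∑ k, S i k • B' k j) (i : α) (j : β') :
    ∑ k, T k j • Φ (α ⊕ β) (Matrix.fromBlocks A B 0 D) (Sum.inl i) (Sum.inr k) =
      ∑ k, S i k • Φ (α' ⊕ β') (Matrix.fromBlocks A' B' 0 D') (Sum.inl k) (Sum.inr j) := by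
  have h := hΦ (α ⊕ β) (α' ⊕ β') (Matrix.fromBlocks A B 0 D) (Matrix.fromBlocks A' B' 0 D')
    (Matrix.fromBlocks S 0 0 T) (hA.fromBlocks hD B) (hA'.fromBlocks hD' B')
    (by
      rintro (i | i) (j | j)
      · simpa [Fintype.sum_sum_type] using hS i j
      · simpa [Fintype.sum_sum_type] using hB i j
      · simp [Fintype.sum_sum_type]
      · simpa [Fintype.sum_sum_type] using hT i j) (Sum.inl i) (Sum.inr j)
  simpa [Fintype.sum_sum_type] using h

theorem Intertwines.fromBlocks_inl_inr_comb (hΦ : Intertwines R Φ) {A : Matrix α α W}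
    {D : Matrix β β W} (hA : Nil R A) (hD : Nil R D) (B B' : Matrix α β W) (a b : R) (i : α)
    (j : β) :
    Φ (α ⊕ β) (Matrix.fromBlocks A (a • B + b • B') 0 D) (Sum.inl i) (Sum.inr j) =
      a • Φ (α ⊕ β) (Matrix.fromBlocks A B 0 D) (Sum.inl i) (Sum.inr j) +
      b • Φ (α ⊕ β) (Matrix.fromBlocks A B' 0 D) (Sum.inl i) (Sum.inr j) := by
  -- All three values are linear images of the value at `[A, 0, B; 0, A, B'; 0, 0, D]`.
  have key : ∀ a b : R,
      Φ (α ⊕ β) (Matrix.fromBlocks A (a • B + b • B') 0 D) (Sum.inl i) (Sum.inr j) =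
      a • Φ ((α ⊕ α) ⊕ β) (Matrix.fromBlocks (Matrix.fromBlocks A 0 0 A) (Matrix.fromRows B B') 0 D)
        (Sum.inl (Sum.inl i)) (Sum.inr j) +
      b • Φ ((α ⊕ α) ⊕ β) (Matrix.fromBlocks (Matrix.fromBlocks A 0 0 A) (Matrix.fromRows B B') 0 D)
        (Sum.inl (Sum.inr i)) (Sum.inr j) := by
    intro a b
    have h := hΦ.fromBlocks_inl_inr_natural hA hD (hA.fromBlocks hA 0) hD (a • B + b • B')
      (Matrix.fromRows B B') (Matrix.fromCols (a • 1) (b • 1)) 1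
      (by rintro i (j | j) <;>
            simp [Fintype.sum_sum_type, Matrix.one_apply, ite_smul])
      (by intro i j; simp [Matrix.one_apply, ite_smul])
      (by
        intro i j
        simp [Fintype.sum_sum_type, Matrix.one_apply, ite_smul, Finset.sum_add_distrib]) i j
    simpa [Fintype.sum_sum_type, Matrix.one_apply, ite_smul] using h
  have h1 := key 1 0
  have h2 := key 0 1
  simp only [one_smul, zero_smul, add_zero, zero_add] at h1 h2
  rw [key, h1, h2]

/-- The map `B ↦ Φ([A, B; 0, D])₁₂`, that is, the difference-differential operator of `Φ`. -/
def Intertwines.upperRight (hΦ : Intertwines R Φ) {A : Matrix α α W}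
    {D : Matrix β β W} (hA : Nil R A) (hD : Nil R D) : Matrix α β W →ₗ[R] Matrix α β O where
  toFun B := Matrix.of fun i j =>
    Φ (α ⊕ β) (Matrix.fromBlocks A B 0 D) (Sum.inl i) (Sum.inr j)
  map_add' B B' := by
    ext i j
    simpa using hΦ.fromBlocks_inl_inr_comb hA hD B B' 1 1 i j
  map_smul' r B := by
    ext i j
    simpa using hΦ.fromBlocks_inl_inr_comb hA hD B 0 r 0 i j

open Classical in
/-- The first order difference quotient of `Φ` at `0` and `q`, as a function of `q` with values in
matrices of linear maps: the entry `(k, j)` sends `w` to the entry `(1, j)` of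
`Φ([0, w eₖ; 0, q])₁₂`, where `eₖ` is a row of the identity matrix. -/
noncomputable def Intertwines.quotient (hΦ : Intertwines R Φ) (μ : Type) [Fintype μ]
    [DecidableEq μ] (q : Matrix μ μ W) : Matrix μ μ (W →ₗ[R] O) :=
  if h : Nil R q then Matrix.of fun k j =>
    (Matrix.entryLinearMap R O () j).comp ((hΦ.upperRight (nil_zero (μ := Unit)) h).comp
      (Matrix.singleLinearMap R () k))
  else 0

theorem Intertwines.sum_quotient (hΦ : Intertwines R Φ) {q : Matrix α α W} (hq : Nil R q)
    (r : Matrix Unit α W) (j : α) :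
    ∑ k, hΦ.quotient α q k j (r () k) =
      Φ (Unit ⊕ α) (Matrix.fromBlocks 0 r 0 q) (Sum.inl ()) (Sum.inr j) := by
  have h : hΦ.upperRight (nil_zero (μ := Unit)) hq r () j =
      Φ (Unit ⊕ α) (Matrix.fromBlocks 0 r 0 q) (Sum.inl ()) (Sum.inr j) := rfl
  rw [← h]
  conv_rhs => rw [Matrix.matrix_eq_sum_single r]
  simp [Intertwines.quotient, hq, Matrix.sum_apply]

theorem Intertwines.intertwines_quotient (hΦ : Intertwines R Φ) :
    Intertwines R (fun μ _ _ => hΦ.quotient μ) := by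
  intro μ ν _ _ _ _ p q T hp hq h i j
  ext w
  have h0 : Nil R (0 : Matrix Unit Unit W) := nil_zero
  have h1 := hΦ.fromBlocks_inl_inr_natural h0 hp h0 hq (Matrix.single () i w)
    (Matrix.of fun _ k => T i k • w) 1 T (by simp) h
    (by intro a b; simp [Matrix.single_apply]) () j
  simp only [LinearMap.sum_apply, LinearMap.smul_apply]
  have h2 := hΦ.sum_quotient hq (Matrix.of fun _ k => T i k • w) j
  simp only [Matrix.of_apply, map_smul] at h2
  rw [h2]
  simpa [Intertwines.quotient, hp, Intertwines.upperRight] using h1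

/-- The first order Taylor formula about `0`. -/
theorem Intertwines.eq_add_sum_quotient (hΦ : Intertwines R Φ) {p : Matrix α α W} (hp : Nil R p)
    (i j : α) :
    Φ α p i j = (if i = j then Φ Unit 0 () () else 0) + ∑ k, hΦ.quotient α p k j (p i k) := by
  have h0 : Nil R (0 : Matrix Unit Unit W) := nil_zero
  let r : Matrix Unit α W := Matrix.of fun _ k => p i k
  -- The column `[eᵢ; 1]` intertwines `[0, eᵢ p; 0, p]` and `p`.
  have h := hΦ (Unit ⊕ α) α (Matrix.fromBlocks 0 r 0 p) p
    (Matrix.fromRows (Matrix.single () i 1) 1) (h0.fromBlocks hp r) hp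
    (by
      rintro (a | a) b <;>
      simp [Fintype.sum_sum_type, Matrix.single_apply, Matrix.one_apply, ite_smul, r])
    (Sum.inl ()) j
  have h1 := hΦ.sum_quotient hp r j
  have h2 := hΦ.fromBlocks_inl_inl h0 hp r () ()
  simp only [Matrix.of_apply, r] at h1
  rw [h1, ← h2]
  simpa [Fintype.sum_sum_type, Matrix.single_apply, Matrix.one_apply, ite_smul] using h.symm

/-- The Taylor formula about `0`. The coefficients of all orders are collected in one linear map
`φ` on the tensor algebra, and the remainder of order `L` is a linear function of the `L`-th
power. -/
theorem Intertwines.exists_taylor_remainder (L : ℕ) {O : Type w} [AddCommGroup O] [Module R O]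
    {Φ : ∀ (μ : Type) [Fintype μ] [DecidableEq μ], Matrix μ μ W → Matrix μ μ O}
    (hΦ : Intertwines R Φ) :
    ∃ φ : TensorAlgebra R W →ₗ[R] O, ∀ (μ : Type) [Fintype μ] [DecidableEq μ] (p : Matrix μ μ W),
      Nil R p → ∃ ρ : μ → μ → TensorAlgebra R W →ₗ[R] O, ∀ i j,
        Φ μ p i j = φ ((∑ l ∈ Finset.range L, p.map (TensorAlgebra.ι R) ^ l) i j) +
          ∑ k, ρ k j ((p.map (TensorAlgebra.ι R) ^ L) i k) := by
  induction L generalizing O with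
  | zero =>
    refine ⟨0, fun μ _ _ p hp => ?_⟩
    have h := fun c : O => exists_linearMap_ι_mul (R := R) (W := W) c 0
    choose ρ hρ _ using h
    refine ⟨fun k j => ρ (Φ μ p k j), fun i j => ?_⟩
    simp [Matrix.one_apply, apply_ite, hρ]
  | succ L ih =>
    obtain ⟨φ', hφ'⟩ := ih hΦ.intertwines_quotient
    obtain ⟨φ, hφ1, hφ⟩ := exists_linearMap_ι_mul (Φ Unit 0 () ()) φ'.flip
    refine ⟨φ, fun μ _ _ p hp => ?_⟩
    obtain ⟨ρ', hρ'⟩ := hφ' μ p hp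
    have h := fun k j => exists_linearMap_ι_mul (R := R) (W := W) 0 (ρ' k j).flip
    choose ρ _ hρ using h
    refine ⟨ρ, fun i j => ?_⟩
    rw [hΦ.eq_add_sum_quotient hp, Finset.sum_range_succ', pow_zero, add_comm _ (1 : Matrix μ μ _),
      Matrix.add_apply, map_add]
    simp only [hρ', LinearMap.add_apply, Finset.sum_add_distrib, LinearMap.sum_apply, pow_succ',
      ← Matrix.mul_sum, Matrix.mul_apply, map_sum, Matrix.map_apply, hφ, hρ, LinearMap.flip_apply,
      ← add_assoc]
    refine congrArg₂ (· + ·) (congrArg (· + _) ?_) Finset.sum_comm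
    rw [Matrix.one_apply]
    split_ifs
    · exact hφ1.symm
    · exact (map_zero φ).symm

theorem Intertwines.exists_taylor (L : ℕ) {O : Type w} [AddCommGroup O] [Module R O]
    {Φ : ∀ (μ : Type) [Fintype μ] [DecidableEq μ], Matrix μ μ W → Matrix μ μ O}
    (hΦ : Intertwines R Φ) :
    ∃ φ : TensorAlgebra R W →ₗ[R] O, ∀ (μ : Type) [Fintype μ] [DecidableEq μ] (p : Matrix μ μ W),
      p.map (TensorAlgebra.ι R) ^ L = 0 →
        Φ μ p = (∑ l ∈ Finset.range L, p.map (TensorAlgebra.ι R) ^ l).map φ := by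
  obtain ⟨φ, hφ⟩ := hΦ.exists_taylor_remainder L
  refine ⟨φ, fun μ _ _ p hp => ?_⟩
  obtain ⟨ρ, hρ⟩ := hφ μ p ⟨L, hp⟩
  ext i j
  simp [hρ, hp]

end Taylor

/-! ### The implicit function theorem for functions of nilpotent matrices -/

section Implicit

universe u w

variable {R : Type u} {W : Type w} [CommRing R] [AddCommGroup W] [Module R W]
variable {μ ν : Type} [Fintype μ] [DecidableEq μ] [Fintype ν] [DecidableEq ν]

/-- The matrices of order at least `K` in `p`, the degree of `p` itself being one: sums of linear
images of powers of `p` with exponents at least `K`. -/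
def orderGE (p : Matrix μ μ W) (K : ℕ) : Submodule R (Matrix μ μ (TensorAlgebra R W)) :=
  Submodule.span R {x | ∃ l, K ≤ l ∧ ∃ χ : TensorAlgebra R W →ₗ[R] TensorAlgebra R W,
    x = (p.map (TensorAlgebra.ι R) ^ l).map χ}

theorem orderGE_anti (p : Matrix μ μ W) {K K' : ℕ} (h : K ≤ K') :
    orderGE (R := R) p K' ≤ orderGE p K :=
  Submodule.span_mono fun _ ⟨l, hl, hx⟩ => ⟨l, h.trans hl, hx⟩

theorem orderGE_eq_bot {p : Matrix μ μ W} {L : ℕ} (hp : p.map (TensorAlgebra.ι R) ^ L = 0) :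
    orderGE (R := R) p L = ⊥ := by
  rw [orderGE, Submodule.span_eq_bot]
  rintro x ⟨l, hl, χ, rfl⟩
  rw [pow_eq_zero_of_le hl hp, Matrix.map_zero _ (map_zero _)]

theorem map_ι_mem_orderGE (p : Matrix μ μ W) : p.map (TensorAlgebra.ι R) ∈ orderGE (R := R) p 1 :=
  Submodule.subset_span ⟨1, le_rfl, LinearMap.id, by ext; simp⟩

theorem map_mem_orderGE {p : Matrix μ μ W} {K : ℕ} {x : Matrix μ μ (TensorAlgebra R W)}
    (hx : x ∈ orderGE p K) (χ : TensorAlgebra R W →ₗ[R] TensorAlgebra R W) :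
    x.map χ ∈ orderGE p K := by
  have h : orderGE p K ≤ (orderGE p K).comap χ.mapMatrix := by
    refine Submodule.span_le.2 ?_
    rintro y ⟨l, hl, χ', rfl⟩
    exact Submodule.subset_span ⟨l, hl, χ.comp χ', by ext; simp⟩
  exact h hx

theorem mul_mem_orderGE {p : Matrix μ μ W} {K K' : ℕ} {x y : Matrix μ μ (TensorAlgebra R W)}
    (hx : x ∈ orderGE p K) (hy : y ∈ orderGE p K') : x * y ∈ orderGE p (K + K') := by
  have h := Submodule.mul_mem_mul hx hy
  rw [orderGE, orderGE, Submodule.span_mul_span] at h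
  refine Submodule.span_mono ?_ h
  rintro _ ⟨_, ⟨l, hl, χ, rfl⟩, _, ⟨l', hl', χ', rfl⟩, rfl⟩
  obtain ⟨χ'', hχ''⟩ := (homogeneous_pow_map_ι (R := R) p l).exists_map_mul_map
    (p.map (TensorAlgebra.ι R) ^ l') χ χ'
  exact ⟨l + l', by omega, χ'', by rw [pow_add]; exact hχ''⟩

theorem pow_mem_orderGE {p : Matrix μ μ W} {x : Matrix μ μ (TensorAlgebra R W)}
    (hx : x ∈ orderGE p 1) (l : ℕ) : x ^ (l + 1) ∈ orderGE p (l + 1) := by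
  induction l with
  | zero => simpa using hx
  | succ l ih => rw [pow_succ]; exact mul_mem_orderGE ih hx

theorem pow_sub_pow_mem_orderGE {p : Matrix μ μ W} {K : ℕ}
    {x y : Matrix μ μ (TensorAlgebra R W)} (hx : x ∈ orderGE p 1) (hy : y ∈ orderGE p 1)
    (hxy : x - y ∈ orderGE p K) (l : ℕ) : x ^ (l + 1) - y ^ (l + 1) ∈ orderGE p (K + l) := by
  induction l with
  | zero => simpa using hxy
  | succ l ih =>
    have h : x ^ (l + 1 + 1) - y ^ (l + 1 + 1) =
        x * (x ^ (l + 1) - y ^ (l + 1)) + (x - y) * y ^ (l + 1) := by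
      rw [pow_succ' x, pow_succ' y, mul_sub, sub_mul, sub_add_sub_cancel]
    rw [h]
    refine Submodule.add_mem _ ?_ (mul_mem_orderGE hxy (pow_mem_orderGE hy l))
    have := mul_mem_orderGE hx ih
    rwa [show 1 + (K + l) = K + (l + 1) by omega] at this

/-- The matrices of order at least `K` in `P` and `P'` around a middle factor `D`: sums of linear
images of products `P ^ a * D * P' ^ b` with `K ≤ a + b`. -/
def sandwichGE (P : Matrix μ μ W) (D : Matrix μ ν W) (P' : Matrix ν ν W) (K : ℕ) :
    Submodule R (Matrix μ ν (TensorAlgebra R W)) :=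
  Submodule.span R {x | ∃ a b, K ≤ a + b ∧ ∃ χ : TensorAlgebra R W →ₗ[R] TensorAlgebra R W,
    x = (P.map (TensorAlgebra.ι R) ^ a * D.map (TensorAlgebra.ι R) *
      P'.map (TensorAlgebra.ι R) ^ b).map χ}

theorem sandwichGE_eq_bot {P : Matrix μ μ W} (D : Matrix μ ν W) {P' : Matrix ν ν W} {k l : ℕ}
    (hP : P.map (TensorAlgebra.ι R) ^ k = 0) (hP' : P'.map (TensorAlgebra.ι R) ^ l = 0) :
    sandwichGE (R := R) P D P' (k + l) = ⊥ := by
  rw [sandwichGE, Submodule.span_eq_bot]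
  rintro x ⟨a, b, hab, χ, rfl⟩
  rcases le_or_gt k a with h | h
  · rw [pow_eq_zero_of_le h hP]
    ext; simp
  · rw [pow_eq_zero_of_le (show l ≤ b by omega) hP']
    ext; simp

theorem map_mem_sandwichGE {P : Matrix μ μ W} {D : Matrix μ ν W} {P' : Matrix ν ν W} {K : ℕ}
    {x : Matrix μ ν (TensorAlgebra R W)} (hx : x ∈ sandwichGE P D P' K)
    (χ : TensorAlgebra R W →ₗ[R] TensorAlgebra R W) : x.map χ ∈ sandwichGE P D P' K := by
  have h : sandwichGE P D P' K ≤ (sandwichGE P D P' K).comap χ.mapMatrix := by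
    refine Submodule.span_le.2 ?_
    rintro y ⟨a, b, hab, χ', rfl⟩
    exact Submodule.subset_span ⟨a, b, hab, χ.comp χ', by ext; simp⟩
  exact h hx

theorem pow_mul_mul_pow_mem_sandwichGE {P : Matrix μ μ W} {D : Matrix μ ν W} {P' : Matrix ν ν W}
    {K : ℕ} {x : Matrix μ ν (TensorAlgebra R W)} (hx : x ∈ sandwichGE P D P' K) (a b : ℕ) :
    P.map (TensorAlgebra.ι R) ^ a * x * P'.map (TensorAlgebra.ι R) ^ b ∈
      sandwichGE P D P' (K + (a + b)) := by
  induction hx using Submodule.span_induction with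
  | mem x hx =>
    obtain ⟨a', b', hab, χ, rfl⟩ := hx
    have hom := homogeneous_pow_map_ι (R := R) P
    obtain ⟨χ₁, h₁⟩ := (hom a).exists_map_mul_map (P.map (TensorAlgebra.ι R) ^ a' *
      D.map (TensorAlgebra.ι R) * P'.map (TensorAlgebra.ι R) ^ b') LinearMap.id χ
    obtain ⟨χ₂, h₂⟩ := ((hom a).mul (((hom a').mul (homogeneous_map_ι D)).mul
      (homogeneous_pow_map_ι P' b'))).exists_map_mul_map
        (P'.map (TensorAlgebra.ι R) ^ b) χ₁ LinearMap.id
    rw [show ∀ y : Matrix μ μ (TensorAlgebra R W), y.map (LinearMap.id (R := R)) = y from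
      fun y => by ext; simp] at h₁
    rw [show ∀ y : Matrix ν ν (TensorAlgebra R W), y.map (LinearMap.id (R := R)) = y from
      fun y => by ext; simp] at h₂
    refine Submodule.subset_span ⟨a + a', b' + b, by omega, χ₂, ?_⟩
    rw [h₁, h₂, pow_add, pow_add]
    simp only [Matrix.mul_assoc]
  | zero => simp
  | add x y _ _ hx hy => rw [Matrix.mul_add, Matrix.add_mul]; exact Submodule.add_mem _ hx hy
  | smul r x _ hx => rw [Matrix.mul_smul, Matrix.smul_mul]; exact Submodule.smul_mem _ r hx

variable {Ψ : ∀ (μ : Type) [Fintype μ] [DecidableEq μ], Matrix μ μ W → Matrix μ μ W}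

/-- The Taylor expansion of `Ψ` in a form adapted to an equation `Ψ = 0` which is solved for the
component in the range of the projection `e`. -/
theorem Intertwines.exists_taylor_normalized (hΨ : Intertwines R Ψ) {e : W →ₗ[R] W}
    (he : ∀ w, e (e w) = e w)
    (hrange : ∀ (μ : Type) [Fintype μ] [DecidableEq μ] (p : Matrix μ μ W) i j,
      e (Ψ μ p i j) = Ψ μ p i j)
    (h₀ : Ψ Unit 0 () () = 0)
    (h₁ : ∀ w, e w = w → Ψ (Unit ⊕ Unit) (Matrix.fromBlocks 0 (Matrix.of fun _ _ => w) 0 0)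
      (Sum.inl ()) (Sum.inr ()) = w)
    (L : ℕ) : ∃ φ : TensorAlgebra R W →ₗ[R] W, (∀ x, e (φ x) = φ x) ∧
      (∀ w, e w = w → φ (TensorAlgebra.ι R w) = w) ∧
      ∀ (μ : Type) [Fintype μ] [DecidableEq μ] (p : Matrix μ μ W),
        p.map (TensorAlgebra.ι R) ^ (L + 2) = 0 →
          Ψ μ p = (p.map (TensorAlgebra.ι R)).map φ +
            ∑ l ∈ Finset.range L, (p.map (TensorAlgebra.ι R) ^ (l + 2)).map φ := by
  obtain ⟨φ', hφ'⟩ := hΨ.exists_taylor (L + 2)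
  let φ := e.comp φ'
  have hφ : ∀ (μ : Type) [Fintype μ] [DecidableEq μ] (p : Matrix μ μ W) (i j : μ),
      p.map (TensorAlgebra.ι R) ^ (L + 2) = 0 →
        Ψ μ p i j = φ ((∑ l ∈ Finset.range L, p.map (TensorAlgebra.ι R) ^ (l + 2)) i j) +
          φ (p.map (TensorAlgebra.ι R) i j) + φ ((1 : Matrix μ μ _) i j) := by
    intro μ _ _ p i j hp
    rw [← hrange, hφ' μ p hp, Finset.sum_range_succ', Finset.sum_range_succ']
    simp [φ]
  have hφ1 : φ 1 = 0 := by
    have h := hφ Unit 0 () () (by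
      rw [Matrix.map_zero _ (map_zero _), zero_pow (Nat.succ_ne_zero _)])
    rw [h₀, Matrix.map_zero _ (map_zero _)] at h
    simpa using h.symm
  refine ⟨φ, fun x => he _, fun w hw => ?_, fun μ _ _ p hp => ?_⟩
  · have hsq : (Matrix.fromBlocks (0 : Matrix Unit Unit W) (Matrix.of fun _ _ => w) 0
        (0 : Matrix Unit Unit W)).map (TensorAlgebra.ι R) ^ 2 = 0 := by
      have h0 : (0 : Matrix Unit Unit W).map (TensorAlgebra.ι R) ^ 1 = 0 := by
        rw [Matrix.map_zero _ (map_zero _), pow_one]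
      exact map_ι_fromBlocks_pow_eq_zero h0 h0
    have h := hφ _ _ (Sum.inl ()) (Sum.inr ()) (pow_eq_zero_of_le (Nat.le_add_left 2 L) hsq)
    rw [h₁ w hw, Finset.sum_eq_zero fun l _ => pow_eq_zero_of_le (Nat.le_add_left 2 l) hsq] at h
    simpa using h.symm
  · ext i j
    rw [hφ μ p i j hp]
    simp only [Matrix.add_apply, Matrix.map_apply, Matrix.sum_apply, map_sum, Matrix.one_apply]
    split_ifs <;> simp [hφ1, add_comm]

/-- For every nilpotent `p`, the equation `Ψ (p + q) = 0` has a solution `q` in the range of `e`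
such that `p + q` is nilpotent. -/
theorem Intertwines.exists_implicit (hΨ : Intertwines R Ψ) {e : W →ₗ[R] W}
    (he : ∀ w, e (e w) = e w)
    (hrange : ∀ (μ : Type) [Fintype μ] [DecidableEq μ] (p : Matrix μ μ W) i j,
      e (Ψ μ p i j) = Ψ μ p i j)
    (h₀ : Ψ Unit 0 () () = 0)
    (h₁ : ∀ w, e w = w → Ψ (Unit ⊕ Unit) (Matrix.fromBlocks 0 (Matrix.of fun _ _ => w) 0 0)
      (Sum.inl ()) (Sum.inr ()) = w)
    {p : Matrix μ μ W} (hp : Nil R p) :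
    ∃ q : Matrix μ μ W, (∀ i j, e (q i j) = q i j) ∧ Nil R (p + q) ∧ Ψ μ (p + q) = 0 := by
  obtain ⟨k, hk⟩ := hp
  obtain ⟨φ, heφ, hφ, hT⟩ := hΨ.exists_taylor_normalized he hrange h₀ h₁ k
  have hk2 : p.map (TensorAlgebra.ι R) ^ (k + 2) = 0 := pow_eq_zero_of_le (Nat.le_add_right k 2) hk
  let j : Matrix μ μ W →ₗ[R] Matrix μ μ (TensorAlgebra R W) := (TensorAlgebra.ι R).mapMatrix
  let φM : Matrix μ μ (TensorAlgebra R W) →ₗ[R] Matrix μ μ W := φ.mapMatrix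
  have hjφ : ∀ {K x}, x ∈ orderGE p K → j (φM x) ∈ orderGE p K := fun hx =>
    map_mem_orderGE hx ((TensorAlgebra.ι R).comp φ)
  have hjp : j p ∈ orderGE p 1 := map_ι_mem_orderGE p
  -- Solutions are the fixed points of `G`, which increases the order of differences.
  let G : Matrix μ μ W → Matrix μ μ W := fun q =>
    -(φM (j p) + ∑ l ∈ Finset.range k, φM (j (p + q) ^ (l + 2)))
  have hG1 : ∀ q, j q ∈ orderGE p 1 → j (G q) ∈ orderGE p 1 := by
    intro q hq
    simp only [G, map_neg, map_add, map_sum]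
    refine Submodule.neg_mem _ (Submodule.add_mem _ (hjφ hjp) (Submodule.sum_mem _ fun l _ => ?_))
    exact hjφ (orderGE_anti p (by omega) (pow_mem_orderGE (Submodule.add_mem _ hjp hq) (l + 1)))
  have hG : ∀ {K q q'}, j q ∈ orderGE p 1 → j q' ∈ orderGE p 1 → j (q - q') ∈ orderGE p K →
      j (G q - G q') ∈ orderGE p (K + 1) := by
    intro K q q' hq hq' hqq
    have h : G q - G q' = -∑ l ∈ Finset.range k,
        φM ((j p + j q) ^ (l + 2) - (j p + j q') ^ (l + 2)) := by
      simp only [G, map_sub, Finset.sum_sub_distrib, map_add]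
      abel
    rw [h, map_neg, map_sum]
    refine Submodule.neg_mem _ (Submodule.sum_mem _ fun l _ => hjφ ?_)
    refine orderGE_anti p (by omega) (pow_sub_pow_mem_orderGE (K := K)
      (Submodule.add_mem _ hjp hq) (Submodule.add_mem _ hjp hq') ?_ (l + 1))
    rwa [add_sub_add_left_eq_sub, ← map_sub]
  have hit : ∀ n, j (G^[n] 0) ∈ orderGE p 1 := by
    intro n
    induction n with
    | zero => simp
    | succ n ih => rw [Function.iterate_succ_apply']; exact hG1 _ ih
  have hdiff : ∀ n, j (G^[n + 1] 0 - G^[n] 0) ∈ orderGE p (n + 1) := by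
    intro n
    induction n with
    | zero => simpa using hit 1
    | succ n ih =>
      rw [Function.iterate_succ_apply' G (n + 1), Function.iterate_succ_apply' G n] at *
      exact hG (by simpa only [Function.iterate_succ_apply'] using hit (n + 1)) (hit n) ih
  have hd := hdiff (k + 1)
  rw [orderGE_eq_bot hk2, Submodule.mem_bot] at hd
  set q := G^[k + 1] 0 with hq
  have hfix : G q = q := by
    rw [Function.iterate_succ_apply'] at hd
    have h := map_ι_injective (hd.trans (map_zero j).symm)
    exact sub_eq_zero.1 h
  have heq : ∀ a b, e (q a b) = q a b := by
    intro a b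
    rw [← hfix]
    simp only [G, φM, LinearMap.mapMatrix_apply, Matrix.neg_apply, Matrix.add_apply,
      Matrix.sum_apply, Matrix.map_apply, map_neg, map_add, map_sum, heφ]
  have hnil : j (p + q) ^ (k + 2) = 0 := by
    have h := pow_mem_orderGE (Submodule.add_mem _ hjp (hit (k + 1))) (k + 1)
    rw [orderGE_eq_bot hk2, Submodule.mem_bot] at h
    rw [map_add]
    exact h
  refine ⟨q, heq, ⟨_, hnil⟩, ?_⟩
  rw [hT μ (p + q) hnil]
  have h1 : φM (j q) = q := by
    ext a b
    exact hφ _ (heq a b)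
  have h2 : φM (j (p + q)) + ∑ l ∈ Finset.range k, φM (j (p + q) ^ (l + 2)) = q - G q := by
    simp only [G, map_add, h1]
    abel
  exact h2.trans (sub_eq_zero.2 hfix.symm)

/-- The partial difference-differential operators of `Ψ` at nilpotent matrices are bijective. -/
theorem Intertwines.existsUnique_upperRight (hΨ : Intertwines R Ψ) {e : W →ₗ[R] W}
    (he : ∀ w, e (e w) = e w)
    (hrange : ∀ (μ : Type) [Fintype μ] [DecidableEq μ] (p : Matrix μ μ W) i j,
      e (Ψ μ p i j) = Ψ μ p i j)
    (h₀ : Ψ Unit 0 () () = 0)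
    (h₁ : ∀ w, e w = w → Ψ (Unit ⊕ Unit) (Matrix.fromBlocks 0 (Matrix.of fun _ _ => w) 0 0)
      (Sum.inl ()) (Sum.inr ()) = w)
    {P : Matrix μ μ W} {P' : Matrix ν ν W} (hP : Nil R P) (hP' : Nil R P') (H : Matrix μ ν W)
    (hH : ∀ i j, e (H i j) = H i j) :
    ∃! D : Matrix μ ν W, (∀ i j, e (D i j) = D i j) ∧ ∀ i j,
      Ψ (μ ⊕ ν) (Matrix.fromBlocks P D 0 P') (Sum.inl i) (Sum.inr j) = H i j := by
  obtain ⟨k, hk⟩ := hP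
  obtain ⟨l, hl⟩ := hP'
  obtain ⟨φ, heφ, hφ, hT⟩ := hΨ.exists_taylor_normalized he hrange h₀ h₁ (k + l)
  -- By the Taylor formula, the operator is `1 + B` on the range of `e`, with `B` nilpotent.
  let B : Module.End R (Matrix μ ν W) :=
    { toFun := fun D => ∑ n ∈ Finset.range (k + l), ∑ a ∈ Finset.range (n + 2),
        (P.map (TensorAlgebra.ι R) ^ a * D.map (TensorAlgebra.ι R) *
          P'.map (TensorAlgebra.ι R) ^ (n + 2 - 1 - a)).map φ
      map_add' := fun D D' => by
        simp only [Matrix.map_add _ (map_add _), Matrix.mul_add, Matrix.add_mul,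
          Finset.sum_add_distrib]
      map_smul' := fun r D => by
        simp only [Matrix.map_smul _ r (map_smul _ r), Matrix.mul_smul, Matrix.smul_mul,
          Finset.smul_sum, RingHom.id_apply] }
  have heB : ∀ D i j, e (B D i j) = B D i j := by
    intro D i j
    simp only [B, LinearMap.coe_mk, AddHom.coe_mk, Matrix.sum_apply, Matrix.map_apply, map_sum, heφ]
  have hB : ∀ D : Matrix μ ν W, (∀ i j, e (D i j) = D i j) → ∀ i j,
      Ψ (μ ⊕ ν) (Matrix.fromBlocks P D 0 P') (Sum.inl i) (Sum.inr j) = ((1 + B) D) i j := by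
    intro D hD i j
    rw [hT _ _ (pow_eq_zero_of_le (Nat.le_add_right _ 2) (map_ι_fromBlocks_pow_eq_zero hk hl)),
      map_ι_fromBlocks]
    simp only [fromBlocks_pow, Matrix.add_apply, Matrix.map_apply, Matrix.sum_apply,
      Matrix.fromBlocks_apply₁₂, hφ _ (hD i j), B, LinearMap.add_apply, Module.End.one_apply,
      LinearMap.coe_mk, AddHom.coe_mk, map_sum]
  have hpow : ∀ n D, ((B ^ n) D).map (TensorAlgebra.ι R) ∈ sandwichGE (R := R) P D P' n := by
    intro n D
    induction n with
    | zero =>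
      exact Submodule.subset_span ⟨0, 0, le_rfl, LinearMap.id, by ext; simp⟩
    | succ n ih =>
      rw [pow_succ', Module.End.mul_apply]
      have h : (B ((B ^ n) D)).map (TensorAlgebra.ι R) =
          ∑ m ∈ Finset.range (k + l), ∑ a ∈ Finset.range (m + 2),
            (P.map (TensorAlgebra.ι R) ^ a * ((B ^ n) D).map (TensorAlgebra.ι R) *
              P'.map (TensorAlgebra.ι R) ^ (m + 2 - 1 - a)).map ((TensorAlgebra.ι R).comp φ) := by
        ext i j
        simp only [B, LinearMap.coe_mk, AddHom.coe_mk, Matrix.sum_apply, Matrix.map_apply, map_sum,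
          LinearMap.comp_apply]
      rw [h]
      refine Submodule.sum_mem _ fun m _ => Submodule.sum_mem _ fun a ha =>
        map_mem_sandwichGE ?_ _
      have ha := Finset.mem_range.1 ha
      refine Submodule.span_mono ?_ (pow_mul_mul_pow_mem_sandwichGE ih a (m + 2 - 1 - a))
      rintro x ⟨c, d, hcd, hx⟩
      exact ⟨c, d, by omega, hx⟩
  have hnil : IsNilpotent B := by
    refine ⟨k + l, LinearMap.ext fun D => ?_⟩
    have h := hpow (k + l) D
    rw [sandwichGE_eq_bot D hk hl, Submodule.mem_bot] at h
    exact map_ι_injective (R := R) (h.trans (Matrix.map_zero _ (map_zero _)).symm)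
  have hbij := (Module.End.isUnit_iff _).1 hnil.isUnit_one_add
  obtain ⟨D, hD⟩ := hbij.2 H
  have heD : ∀ i j, e (D i j) = D i j := by
    intro i j
    have h : D = H - B D := by
      rw [← hD, LinearMap.add_apply, Module.End.one_apply, add_sub_cancel_right]
    rw [h, Matrix.sub_apply, map_sub, hH, heB]
  refine ⟨D, ⟨heD, fun i j => by rw [hB D heD, hD]⟩, ?_⟩
  rintro D' ⟨heD', h⟩
  refine hbij.1 (Eq.trans ?_ hD.symm)
  ext i j
  rw [← h, hB D' heD']

end Implicit

/-! ### Intertwinings of nc functions -/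

section Intertwining

variable {R M N : Type*} [CommRing R] [AddCommGroup M] [Module R M] [AddCommGroup N] [Module R N]
variable {n m : ℕ}

theorem rmul_mul {p q r t : ℕ} (X : Matrix (Fin p) (Fin q) M) (S : Matrix (Fin q) (Fin r) R)
    (T : Matrix (Fin r) (Fin t) R) : rmul X (S * T) = rmul (rmul X S) T := by
  ext i j
  simp only [rmul, Matrix.of_apply, Matrix.mul_apply, Finset.sum_smul, Finset.smul_sum, smul_smul]
  rw [Finset.sum_comm]
  simp only [mul_comm]

theorem rmul_one {p q : ℕ} (X : Matrix (Fin p) (Fin q) M) :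
    rmul X (1 : Matrix (Fin q) (Fin q) R) = X := by
  ext i j
  simp [rmul, Matrix.one_apply, ite_smul]

theorem conj_rmul (S : (Matrix (Fin n) (Fin n) R)ˣ) (X : Matrix (Fin n) (Fin n) M) :
    rmul (conj S X) (S : Matrix (Fin n) (Fin n) R) = lmul (S : Matrix (Fin n) (Fin n) R) X := by
  rw [conj, ← rmul_mul, Units.inv_mul, rmul_one]

theorem eq_conj_iff_rmul_eq (S : (Matrix (Fin n) (Fin n) R)ˣ) (X Y : Matrix (Fin n) (Fin n) M) :
    Y = conj S X ↔
      rmul Y (S : Matrix (Fin n) (Fin n) R) = lmul (S : Matrix (Fin n) (Fin n) R) X := by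
  refine ⟨fun h => h ▸ conj_rmul S X, fun h => ?_⟩
  rw [conj, ← h, ← rmul_mul, Units.mul_inv, rmul_one]

/-- The invertible scalar matrix `[1, T; 0, 1]`. -/
def upperUnit (T : Matrix (Fin n) (Fin m) R) : (Matrix (Fin (n + m)) (Fin (n + m)) R)ˣ where
  val := blockUpper 1 T 1
  inv := blockUpper 1 (-T) 1
  val_inv := by
    simp [blockUpper, Matrix.submatrix_mul_equiv, Matrix.fromBlocks_multiply,
      Matrix.fromBlocks_one]
  inv_val := by
    simp [blockUpper, Matrix.submatrix_mul_equiv, Matrix.fromBlocks_multiply,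
      Matrix.fromBlocks_one]

theorem conj_upperUnit_directSum (T : Matrix (Fin n) (Fin m) R) (X : Matrix (Fin n) (Fin n) M)
    (Y : Matrix (Fin m) (Fin m) M) :
    conj (upperUnit T) (directSum X Y) = blockUpper X (lmul T Y - rmul X T) Y := by
  have hv : (upperUnit T : Matrix (Fin (n + m)) (Fin (n + m)) R) = blockUpper 1 T 1 := rfl
  have hi : (((upperUnit T)⁻¹ : (Matrix (Fin (n + m)) (Fin (n + m)) R)ˣ) :
    Matrix (Fin (n + m)) (Fin (n + m)) R) = blockUpper 1 (-T) 1 := rfl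
  ext i j
  rw [conj, hv, hi]
  refine Fin.addCases (fun i => ?_) (fun i => ?_) i <;>
    refine Fin.addCases (fun j => ?_) (fun j => ?_) j <;>
    simp [lmul, rmul, directSum, blockUpper, Fin.sum_univ_add, Matrix.one_apply, ite_smul]
  abel

@[simp] theorem block12_blockUpper (X : Matrix (Fin n) (Fin n) M) (Z : Matrix (Fin n) (Fin m) M)
    (Y : Matrix (Fin m) (Fin m) M) : block12 (blockUpper X Z Y) = Z := by
  ext i j
  simp [block12, blockUpper]

theorem conj_upperUnit_zero (T : Matrix (Fin n) (Fin m) R) :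
    conj (upperUnit T) (0 : Matrix (Fin (n + m)) (Fin (n + m)) M) = 0 := by
  ext i j
  simp [conj, lmul, rmul]

theorem directSum_zero : directSum (0 : Matrix (Fin n) (Fin n) M) (0 : Matrix (Fin m) (Fin m) M) =
    0 := by
  simp [directSum, blockUpper]

/-- Nc functions respect intertwinings by arbitrary rectangular scalar matrices. -/
theorem IsNCFunctionOn.rmul_eq_lmul {Ω : GradedSet M} (hΩ : IsNCSet Ω) {f : GradedMap M N}
    (hf : IsNCFunctionOn R Ω f) {X : Matrix (Fin n) (Fin n) M} {Y : Matrix (Fin m) (Fin m) M}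
    (hX : X ∈ Ω n) (hY : Y ∈ Ω m) (T : Matrix (Fin n) (Fin m) R) (h : rmul X T = lmul T Y) :
    rmul (f n X) T = lmul T (f m Y) := by
  -- `[1, T; 0, 1]` commutes with `X ⊕ Y`, hence with `f X ⊕ f Y`.
  have h1 : conj (upperUnit T) (directSum X Y) = directSum X Y := by
    rw [conj_upperUnit_directSum, h, sub_self, directSum]
  have h2 := hf.map_conj (directSum X Y) (upperUnit T) (hΩ.directSum_mem X Y hX hY)
    (by rw [h1]; exact hΩ.directSum_mem X Y hX hY)
  rw [h1, hf.map_directSum X Y hX hY, conj_upperUnit_directSum] at h2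
  have h3 := congrArg block12 h2
  rw [directSum, block12_blockUpper, block12_blockUpper] at h3
  exact (sub_eq_zero.1 h3.symm).symm

/-- The values of a nc function at block upper triangular matrices are block upper triangular. -/
theorem IsNCFunctionOn.map_blockUpper {Ω : GradedSet M} (hΩ : IsNCSet Ω) {f : GradedMap M N}
    (hf : IsNCFunctionOn R Ω f) {X : Matrix (Fin n) (Fin n) M} {Y : Matrix (Fin m) (Fin m) M}
    {Z : Matrix (Fin n) (Fin m) M} (hX : X ∈ Ω n) (hY : Y ∈ Ω m)
    (hXY : blockUpper X Z Y ∈ Ω (n + m)) :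
    f (n + m) (blockUpper X Z Y) =
      blockUpper (f n X) (block12 (f (n + m) (blockUpper X Z Y))) (f m Y) := by
  let T : Matrix (Fin (n + m)) (Fin n) R :=
    Matrix.of (Fin.addCases (fun i j => if i = j then 1 else 0) (fun _ _ => 0))
  let S : Matrix (Fin m) (Fin (n + m)) R :=
    Matrix.of fun i => Fin.addCases (fun _ => 0) (fun j => if i = j then 1 else 0)
  have hT := hf.rmul_eq_lmul hΩ hXY hX T (by
    ext i j
    refine Fin.addCases (fun i => ?_) (fun i => ?_) i <;>
      simp [rmul, lmul, T, Fin.sum_univ_add, blockUpper, ite_smul])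
  have hS := hf.rmul_eq_lmul hΩ hY hXY S (by
    ext i j
    refine Fin.addCases (fun j => ?_) (fun j => ?_) j <;>
      simp [rmul, lmul, S, Fin.sum_univ_add, blockUpper, ite_smul])
  ext i j
  refine Fin.addCases (fun j => ?_) (fun j => ?_) j
  · have h := congrFun (congrFun hT i) j
    revert h
    refine Fin.addCases (fun i => ?_) (fun i => ?_) i <;>
      simp [rmul, lmul, T, Fin.sum_univ_add, blockUpper, ite_smul]
  · refine Fin.addCases (fun i => ?_) (fun i => ?_) i
    · simp [blockUpper, block12]
    · have h := congrFun (congrFun hS i) (Fin.natAdd n j)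
      simp only [rmul, lmul, S, Fin.sum_univ_add, Matrix.of_apply, Fin.addCases_left,
        Fin.addCases_right, ite_smul, zero_smul, one_smul, Finset.sum_const_zero,
        Finset.sum_ite_eq, Finset.sum_ite_eq', Finset.mem_univ, if_true, zero_add] at h
      simpa [blockUpper] using h.symm

end Intertwining

/-! ### Nc functions as functions of block matrices -/

section Blocks

variable {R M O : Type*} [CommRing R] [AddCommGroup M] [Module R M] [AddCommGroup O] [Module R O]
variable {μ ν : Type} {s n m : ℕ}

/-- The matrix of size `n × m` obtained from a matrix of `s × s` blocks, where `e` and `e'`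
enumerate the rows and the columns. -/
def flatten {M : Type*} (e : μ × Fin s ≃ Fin n) (e' : ν × Fin s ≃ Fin m)
    (P : Matrix μ ν (Matrix (Fin s) (Fin s) M)) : Matrix (Fin n) (Fin m) M :=
  Matrix.of fun x y => P (e.symm x).1 (e'.symm y).1 (e.symm x).2 (e'.symm y).2

@[simp] theorem flatten_apply {M : Type*} (e : μ × Fin s ≃ Fin n) (e' : ν × Fin s ≃ Fin m)
    (P : Matrix μ ν (Matrix (Fin s) (Fin s) M)) (i : μ) (j : ν) (a b : Fin s) :
    flatten e e' P (e (i, a)) (e' (j, b)) = P i j a b := by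
  simp [flatten]

theorem flatten_bijective {M : Type*} (e : μ × Fin s ≃ Fin n) (e' : ν × Fin s ≃ Fin m) :
    Function.Bijective (flatten (M := M) e e') := by
  refine ⟨fun P Q h => ?_, fun X =>
    ⟨Matrix.of fun i j => Matrix.of fun a b => X (e (i, a)) (e' (j, b)), ?_⟩⟩
  · ext i j a b
    rw [← flatten_apply e e' P, h, flatten_apply]
  · ext x y
    simp [flatten]

/-- The rows of the direct sum of two block matrices, enumerated one summand after the other. -/
def sumBlockEquiv (e : μ × Fin s ≃ Fin n) (e' : ν × Fin s ≃ Fin m) :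
    (μ ⊕ ν) × Fin s ≃ Fin (n + m) :=
  ((Equiv.sumProdDistrib μ ν (Fin s)).trans (e.sumCongr e')).trans finSumFinEquiv

theorem blockUpper_flatten (e : μ × Fin s ≃ Fin n) (e' : ν × Fin s ≃ Fin m)
    (P : Matrix μ μ (Matrix (Fin s) (Fin s) M)) (Z : Matrix μ ν (Matrix (Fin s) (Fin s) M))
    (Q : Matrix ν ν (Matrix (Fin s) (Fin s) M)) :
    blockUpper (flatten e e P) (flatten e e' Z) (flatten e' e' Q) =
      flatten (sumBlockEquiv e e') (sumBlockEquiv e e') (Matrix.fromBlocks P Z 0 Q) := by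
  ext x y
  refine Fin.addCases (fun x => ?_) (fun x => ?_) x <;>
    refine Fin.addCases (fun y => ?_) (fun y => ?_) y <;>
    simp [blockUpper, flatten, sumBlockEquiv]

theorem block12_flatten {M : Type*} (e : μ × Fin s ≃ Fin n) (e' : ν × Fin s ≃ Fin m)
    (P : Matrix (μ ⊕ ν) (μ ⊕ ν) (Matrix (Fin s) (Fin s) M)) :
    block12 (flatten (sumBlockEquiv e e') (sumBlockEquiv e e') P) = flatten e e' P.toBlocks₁₂ := by
  ext x y
  simp [block12, flatten, sumBlockEquiv, Matrix.toBlocks₁₂]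

theorem diagonal_const_apply {M : Type*} [Zero M] [DecidableEq μ] (C : Matrix (Fin s) (Fin s) M)
    (i j : μ) (a b : Fin s) :
    Matrix.diagonal (fun _ => C) i j a b = if i = j then C a b else 0 := by
  rw [Matrix.diagonal_apply]
  split_ifs <;> rfl

variable [Fintype μ] [DecidableEq μ] [Fintype ν] [DecidableEq ν]

theorem mem_nilp_iff {C : Matrix (Fin s) (Fin s) M} {X : Matrix (Fin n) (Fin n) M} :
    X ∈ Nilp R C n ↔ ∃ (m : ℕ) (h : m * s = n)
      (P : Matrix (Fin m) (Fin m) (Matrix (Fin s) (Fin s) M)), 1 ≤ m ∧ Nil R P ∧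
        X = flatten (finProdFinEquiv.trans (finCongr h))
        (finProdFinEquiv.trans (finCongr h)) (Matrix.diagonal (fun _ => C) + P) := by
  constructor
  · rintro ⟨m, κ, rfl, hm, -, h⟩
    refine ⟨m, rfl, toSBlocks (X - ampliation C m), hm, ⟨κ, h κ le_rfl⟩, ?_⟩
    obtain ⟨Q, rfl⟩ := (flatten_bijective finProdFinEquiv finProdFinEquiv).2 X
    refine congrArg _ ?_
    ext i j a b
    simp only [toSBlocks, ampliation, Matrix.add_apply, diagonal_const_apply, Matrix.of_apply,
      Matrix.sub_apply, Equiv.symm_apply_apply, flatten_apply, add_sub_cancel]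
  · rintro ⟨m, rfl, P, hm, ⟨k, hk⟩, rfl⟩
    refine ⟨m, k + 1, rfl, hm, Nat.le_add_left 1 k, fun l hl => ?_⟩
    have h : tensorMatrix R (flatten finProdFinEquiv finProdFinEquiv
        (Matrix.diagonal (fun _ => C) + P) - ampliation C m) = P.map (TensorAlgebra.ι R) := by
      refine congrArg (fun Q : Matrix (Fin m) (Fin m) (Matrix (Fin s) (Fin s) M) =>
        Q.map (TensorAlgebra.ι R)) ?_
      ext i j a b
      simp only [toSBlocks, ampliation, Matrix.add_apply, diagonal_const_apply, Matrix.of_apply,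
        Matrix.sub_apply, Equiv.symm_apply_apply, flatten_apply, add_sub_cancel_left]
    exact (congrArg (· ^ l) h).trans (pow_eq_zero_of_le (by omega) hk)

/-- An enumeration of the rows of a block matrix in which blocks are consecutive. -/
noncomputable def blockEquiv (s : ℕ) (μ : Type) [Fintype μ] :
    μ × Fin s ≃ Fin (Fintype.card μ * s) :=
  ((Fintype.equivFin μ).prodCongr (Equiv.refl _)).trans finProdFinEquiv

theorem flatten_mem_nilp [Nonempty μ] (C : Matrix (Fin s) (Fin s) M)
    {P : Matrix μ μ (Matrix (Fin s) (Fin s) M)} (hP : Nil R P) :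
    flatten (blockEquiv s μ) (blockEquiv s μ) (Matrix.diagonal (fun _ => C) + P) ∈
      Nilp R C (Fintype.card μ * s) := by
  obtain ⟨k, hk⟩ := hP
  refine mem_nilp_iff.2 ⟨Fintype.card μ, rfl, P.submatrix (Fintype.equivFin μ).symm
    (Fintype.equivFin μ).symm, Fintype.card_pos, ⟨k, ?_⟩, ?_⟩
  · have h := congrArg (Matrix.reindexAlgEquiv R (TensorAlgebra R (Matrix (Fin s) (Fin s) M))
      (Fintype.equivFin μ)) hk
    rw [map_pow, map_zero] at h
    exact h
  · ext x y
    simp [flatten, blockEquiv, Matrix.diagonal_apply]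

theorem IsNCFunctionOn.flatten_intertwine (hs : 1 ≤ s) {C : Matrix (Fin s) (Fin s) M}
    {F : GradedMap M O} (hF : IsNCFunctionOn R (Nilp R C) F) (e : μ × Fin s ≃ Fin n)
    (e' : ν × Fin s ≃ Fin m) {P : Matrix μ μ (Matrix (Fin s) (Fin s) M)}
    {Q : Matrix ν ν (Matrix (Fin s) (Fin s) M)} (T : Matrix μ ν R)
    (hP : flatten e e (Matrix.diagonal (fun _ => C) + P) ∈ Nilp R C n)
    (hQ : flatten e' e' (Matrix.diagonal (fun _ => C) + Q) ∈ Nilp R C m)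
    (h : ∀ i j, ∑ k, T k j • P i k = ∑ k, T i k • Q k j) (i : μ) (j : ν) (a b : Fin s) :
    ∑ k, T k j • F n (flatten e e (Matrix.diagonal (fun _ => C) + P)) (e (i, a)) (e (k, b)) =
      ∑ k, T i k •
        F m (flatten e' e' (Matrix.diagonal (fun _ => C) + Q)) (e' (k, a)) (e' (j, b)) := by
  let T' : Matrix (Fin n) (Fin m) R := Matrix.of fun x y =>
    if (e.symm x).2 = (e'.symm y).2 then T (e.symm x).1 (e'.symm y).1 else 0
  have key := hF.rmul_eq_lmul (isNCSet_nilp hs C) hP hQ T' (by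
    ext x y
    obtain ⟨⟨i, a⟩, rfl⟩ := e.surjective x
    obtain ⟨⟨j, b⟩, rfl⟩ := e'.surjective y
    have h' := congrFun (congrFun (h i j) a) b
    simp only [Matrix.sum_apply, Matrix.smul_apply] at h'
    simp only [rmul, lmul, T', ← e.sum_comp, ← e'.sum_comp, Fintype.sum_prod_type]
    simp [ite_smul, smul_add, Finset.sum_add_distrib, h', diagonal_const_apply])
  have h2 := congrFun (congrFun key (e (i, a))) (e' (j, b))
  simp only [rmul, lmul, T', ← e.sum_comp, ← e'.sum_comp, Fintype.sum_prod_type] at h2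
  simpa [ite_smul] using h2

/-- A nc function on the matrices nilpotent about `C` as a function of the matrix of blocks, taken
relative to the center `C`. -/
noncomputable def atBlocks (C : Matrix (Fin s) (Fin s) M) (F : GradedMap M O) (μ : Type)
    [Fintype μ] [DecidableEq μ] (P : Matrix μ μ (Matrix (Fin s) (Fin s) M)) :
    Matrix μ μ (Matrix (Fin s) (Fin s) O) :=
  Matrix.of fun i j => Matrix.of fun a b =>
    F _ (flatten (blockEquiv s μ) (blockEquiv s μ) (Matrix.diagonal (fun _ => C) + P))
      (blockEquiv s μ (i, a)) (blockEquiv s μ (j, b))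

theorem IsNCFunctionOn.intertwines_atBlocks (hs : 1 ≤ s) {C : Matrix (Fin s) (Fin s) M}
    {F : GradedMap M O} (hF : IsNCFunctionOn R (Nilp R C) F) : Intertwines R (atBlocks C F) := by
  intro μ ν _ _ _ _ P Q T hP hQ h i j
  have : Nonempty μ := ⟨i⟩
  have : Nonempty ν := ⟨j⟩
  ext a b
  simpa [atBlocks, Matrix.sum_apply] using hF.flatten_intertwine hs (blockEquiv s μ)
    (blockEquiv s ν) T (flatten_mem_nilp C hP) (flatten_mem_nilp C hQ) h i j a b

/-- The blocks of `F X` do not depend on the enumeration of the rows of `X`. -/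
theorem IsNCFunctionOn.flatten_eq_atBlocks (hs : 1 ≤ s) {C : Matrix (Fin s) (Fin s) M}
    {F : GradedMap M O} (hF : IsNCFunctionOn R (Nilp R C) F) (e : μ × Fin s ≃ Fin n)
    {P : Matrix μ μ (Matrix (Fin s) (Fin s) M)} (hP : Nil R P)
    (hX : flatten e e (Matrix.diagonal (fun _ => C) + P) ∈ Nilp R C n) :
    F n (flatten e e (Matrix.diagonal (fun _ => C) + P)) = flatten e e (atBlocks C F μ P) := by
  ext x y
  obtain ⟨⟨i, a⟩, rfl⟩ := e.surjective x
  obtain ⟨⟨j, b⟩, rfl⟩ := e.surjective y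
  have : Nonempty μ := ⟨i⟩
  simpa [Matrix.one_apply, ite_smul, atBlocks] using hF.flatten_intertwine (Q := P) hs e
    (blockEquiv s μ) 1 hX (flatten_mem_nilp C hP)
    (by intro i j; simp [Matrix.one_apply, ite_smul]) i j a b

end Blocks

/-! ### The difference-differential operator on nilpotent matrices -/

section Delta

variable {R M O : Type*} [CommRing R] [AddCommGroup M] [Module R M] [AddCommGroup O] [Module R O]
variable {s n m : ℕ} {C : Matrix (Fin s) (Fin s) M} {F : GradedMap M O}

theorem IsNCFunctionOn.deltaR_nilp (hF : IsNCFunctionOn R (Nilp R C) F)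
    {A : Matrix (Fin n) (Fin n) M} {B : Matrix (Fin m) (Fin m) M} (hA : A ∈ Nilp R C n)
    (hB : B ∈ Nilp R C m) (Z : Matrix (Fin n) (Fin m) M) :
    deltaR R (Nilp R C) F A B Z = block12 (F (n + m) (blockUpper A Z B)) := by
  rw [deltaR_eq hF A B Z 1 (blockUpper_mem_nilp C A B _ hA hB)]
  simp

theorem diagonal_const_add_fromBlocks {μ ν : Type} [DecidableEq μ] [DecidableEq ν]
    (P : Matrix μ μ (Matrix (Fin s) (Fin s) M)) (Z : Matrix μ ν (Matrix (Fin s) (Fin s) M))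
    (Q : Matrix ν ν (Matrix (Fin s) (Fin s) M)) :
    Matrix.fromBlocks (Matrix.diagonal (fun _ => C) + P) Z 0 (Matrix.diagonal (fun _ => C) + Q) =
      Matrix.diagonal (fun _ => C) + Matrix.fromBlocks P Z 0 Q := by
  ext i j : 2
  rcases i with i | i <;> rcases j with j | j <;> simp [Matrix.diagonal_apply]

variable {μ ν : Type} [Fintype μ] [DecidableEq μ] [Fintype ν] [DecidableEq ν]

theorem IsNCFunctionOn.deltaR_flatten (hs : 1 ≤ s) (hF : IsNCFunctionOn R (Nilp R C) F)
    (e : μ × Fin s ≃ Fin n) (e' : ν × Fin s ≃ Fin m)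
    {P : Matrix μ μ (Matrix (Fin s) (Fin s) M)} {Q : Matrix ν ν (Matrix (Fin s) (Fin s) M)}
    (hP : Nil R P) (hQ : Nil R Q)
    (hA : flatten e e (Matrix.diagonal (fun _ => C) + P) ∈ Nilp R C n)
    (hB : flatten e' e' (Matrix.diagonal (fun _ => C) + Q) ∈ Nilp R C m)
    (Z : Matrix μ ν (Matrix (Fin s) (Fin s) M)) :
    deltaR R (Nilp R C) F (flatten e e (Matrix.diagonal (fun _ => C) + P))
      (flatten e' e' (Matrix.diagonal (fun _ => C) + Q)) (flatten e e' Z) =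
      flatten e e' ((hF.intertwines_atBlocks hs).upperRight hP hQ Z) := by
  have hU := blockUpper_mem_nilp C _ _ (flatten e e' Z) hA hB
  rw [hF.deltaR_nilp hA hB]
  rw [blockUpper_flatten, diagonal_const_add_fromBlocks] at hU ⊢
  rw [hF.flatten_eq_atBlocks hs _ (hP.fromBlocks hQ Z) hU, block12_flatten]
  rfl

theorem IsNCFunctionOn.deltaR_add (hs : 1 ≤ s) (hF : IsNCFunctionOn R (Nilp R C) F)
    {A : Matrix (Fin n) (Fin n) M} {B : Matrix (Fin m) (Fin m) M} (hA : A ∈ Nilp R C n)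
    (hB : B ∈ Nilp R C m) (Z Z' : Matrix (Fin n) (Fin m) M) :
    deltaR R (Nilp R C) F A B (Z + Z') =
      deltaR R (Nilp R C) F A B Z + deltaR R (Nilp R C) F A B Z' := by
  obtain ⟨a, ha, P, -, hP, rfl⟩ := mem_nilp_iff.1 hA
  obtain ⟨b, hb, Q, -, hQ, rfl⟩ := mem_nilp_iff.1 hB
  obtain ⟨Z, rfl⟩ := (flatten_bijective (finProdFinEquiv.trans (finCongr ha))
    (finProdFinEquiv.trans (finCongr hb))).2 Z
  obtain ⟨Z', rfl⟩ := (flatten_bijective (finProdFinEquiv.trans (finCongr ha))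
    (finProdFinEquiv.trans (finCongr hb))).2 Z'
  have h : ∀ {L : Type _} [Add L] {μ ν : Type} (e : μ × Fin s ≃ Fin n) (e' : ν × Fin s ≃ Fin m)
    (X Y : Matrix μ ν (Matrix (Fin s) (Fin s) L)), flatten e e' X + flatten e e' Y =
      flatten e e' (X + Y) := fun _ _ _ _ => rfl
  rw [hF.deltaR_flatten hs _ _ hP hQ hA hB, hF.deltaR_flatten hs _ _ hP hQ hA hB, h,
    hF.deltaR_flatten hs _ _ hP hQ hA hB, map_add]
  rfl

theorem IsNCFunctionOn.deltaR_smul (hs : 1 ≤ s) (hF : IsNCFunctionOn R (Nilp R C) F)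
    {A : Matrix (Fin n) (Fin n) M} {B : Matrix (Fin m) (Fin m) M} (hA : A ∈ Nilp R C n)
    (hB : B ∈ Nilp R C m) (r : R) (Z : Matrix (Fin n) (Fin m) M) :
    deltaR R (Nilp R C) F A B (r • Z) = r • deltaR R (Nilp R C) F A B Z := by
  obtain ⟨a, ha, P, -, hP, rfl⟩ := mem_nilp_iff.1 hA
  obtain ⟨b, hb, Q, -, hQ, rfl⟩ := mem_nilp_iff.1 hB
  obtain ⟨Z, rfl⟩ := (flatten_bijective (finProdFinEquiv.trans (finCongr ha))
    (finProdFinEquiv.trans (finCongr hb))).2 Z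
  rw [hF.deltaR_flatten hs _ _ hP hQ hA hB]
  refine (hF.deltaR_flatten hs _ _ hP hQ hA hB (r • Z)).trans ?_
  rw [map_smul]
  rfl

end Delta

/-! ### Linear maps applied to nilpotent matrices -/

section Map

variable {R V W : Type*} [CommRing R] [AddCommGroup V] [Module R V] [AddCommGroup W] [Module R W]

theorem Nil.map {μ : Type} [Fintype μ] [DecidableEq μ] {p : Matrix μ μ V} (hp : Nil R p)
    (g : V →ₗ[R] W) : Nil R (p.map g) := by
  have h : (p.map g).map (TensorAlgebra.ι R) =
      (TensorAlgebra.lift R ((TensorAlgebra.ι R).comp g)).mapMatrix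
        (p.map (TensorAlgebra.ι R)) := by
    ext i j
    simp
  rw [Nil, h]
  exact IsNilpotent.map hp _

theorem map_mem_nilp {s n : ℕ} {C : Matrix (Fin s) (Fin s) V} {X : Matrix (Fin n) (Fin n) V}
    (hX : X ∈ Nilp R C n) (g : V →ₗ[R] W) : X.map g ∈ Nilp R (C.map g) n := by
  obtain ⟨m, h, P, hm, hP, rfl⟩ := mem_nilp_iff.1 hX
  refine mem_nilp_iff.2 ⟨m, h, P.map g.mapMatrix, hm, hP.map _, ?_⟩
  ext x y
  simp [flatten, diagonal_const_apply, apply_ite]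

theorem Intertwines.map {W' : Type*} [AddCommGroup W'] [Module R W']
    {Φ : ∀ (μ : Type) [Fintype μ] [DecidableEq μ], Matrix μ μ V → Matrix μ μ W}
    (hΦ : Intertwines R Φ) (g : W →ₗ[R] W') :
    Intertwines R (fun μ _ _ p => (Φ μ p).map g) := by
  intro μ ν _ _ _ _ p q T hp hq h i j
  have h' := congrArg g (hΦ μ ν p q T hp hq h i j)
  simpa only [map_sum, map_smul, Matrix.map_apply] using h'

end Map

/-! ### Implicit functions -/

section Implicit

variable {R M N O : Type*} [CommRing R] [AddCommGroup M] [Module R M]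
  [AddCommGroup N] [Module R N] [AddCommGroup O] [Module R O]
variable {s n m : ℕ} {X₀ : Matrix (Fin s) (Fin s) M} {Y₀ : Matrix (Fin s) (Fin s) N}
  {F : GradedMap (M × N) O}

theorem fst_mem_nilp {X : Matrix (Fin n) (Fin n) M} {Y : Matrix (Fin n) (Fin n) N}
    (h : pair X Y ∈ Nilp R (pair X₀ Y₀) n) : X ∈ Nilp R X₀ n :=
  map_mem_nilp h (LinearMap.fst R M N)

theorem snd_mem_nilp {X : Matrix (Fin n) (Fin n) M} {Y : Matrix (Fin n) (Fin n) N}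
    (h : pair X Y ∈ Nilp R (pair X₀ Y₀) n) : Y ∈ Nilp R Y₀ n :=
  map_mem_nilp h (LinearMap.snd R M N)

variable (R M N s) in
/-- The projection of the pairs of `s × s` matrices onto the second components. -/
def sndProj : Matrix (Fin s) (Fin s) (M × N) →ₗ[R] Matrix (Fin s) (Fin s) (M × N) :=
  ((LinearMap.inr R M N).comp (LinearMap.snd R M N)).mapMatrix

theorem sndProj_eq_self_iff {w : Matrix (Fin s) (Fin s) (M × N)} :
    sndProj R M N s w = w ↔ ∀ a b, (w a b).1 = 0 := by
  simp [sndProj, ← Matrix.ext_iff, Prod.ext_iff, eq_comm]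

/-- The blocks of `F`, composed with a linear injection of `Oˢˣˢ` into the second components of
`(M × N)ˢˣˢ`, satisfy the normalization under which the implicit function theorem for functions of
nilpotent matrices applies: the linear injection is the inverse of `Δ_R^Y F` at the center. -/
theorem exists_normalization (hs : 1 ≤ s) (hF : IsNCFunctionOn R (Nilp R (pair X₀ Y₀)) F)
    (hF₀ : F s (pair X₀ Y₀) = 0)
    (hinv : Function.Bijective (deltaRY R (Nilp R (pair X₀ Y₀)) F X₀ Y₀)) :
    ∃ lam : Matrix (Fin s) (Fin s) O →ₗ[R] Matrix (Fin s) (Fin s) (M × N),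
      Function.Injective lam ∧ (∀ o, sndProj R M N s (lam o) = lam o) ∧
      lam (atBlocks (pair X₀ Y₀) F Unit 0 () ()) = 0 ∧
      ∀ w, sndProj R M N s w = w → lam (atBlocks (pair X₀ Y₀) F (Unit ⊕ Unit)
        (Matrix.fromBlocks 0 (Matrix.of fun _ _ => w) 0 0) (Sum.inl ()) (Sum.inr ())) = w := by
  have hC := center_mem_nilp (R := R) (pair X₀ Y₀)
  let D : Matrix (Fin s) (Fin s) N →ₗ[R] Matrix (Fin s) (Fin s) O :=
    { toFun := deltaRY R (Nilp R (pair X₀ Y₀)) F X₀ Y₀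
      map_add' := fun Z Z' => by
        rw [deltaRY, deltaRY, deltaRY, ← hF.deltaR_add hs hC hC]
        congr 1
        ext <;> simp [pair]
      map_smul' := fun r Z => by
        rw [deltaRY, deltaRY, RingHom.id_apply, ← hF.deltaR_smul hs hC hC]
        congr 1
        ext <;> simp [pair] }
  let A := LinearEquiv.ofBijective D hinv
  let lam : Matrix (Fin s) (Fin s) O →ₗ[R] Matrix (Fin s) (Fin s) (M × N) :=
    (LinearMap.inr R M N).mapMatrix.comp A.symm.toLinearMap
  let e₀ : Unit × Fin s ≃ Fin s := Equiv.punitProd (Fin s)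
  have hfl : flatten e₀ e₀ (Matrix.diagonal (fun _ => pair X₀ Y₀) + 0) = pair X₀ Y₀ := by
    ext <;> simp [flatten, e₀]
  refine ⟨lam, fun o o' h => A.symm.injective ?_, fun o => ?_, ?_, fun w hw => ?_⟩
  · ext a b
    exact congrArg Prod.snd (congrFun (congrFun h a) b)
  · exact sndProj_eq_self_iff.2 fun a b => rfl
  · have h := hF.flatten_eq_atBlocks hs e₀ (nil_zero (μ := Unit)) (by rw [hfl]; exact hC)
    rw [hfl, hF₀] at h
    have h0 : atBlocks (pair X₀ Y₀) F Unit 0 () () = 0 := by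
      ext a b
      exact (congrFun (congrFun h a) b).symm
    rw [h0, map_zero]
  · have h := hF.deltaR_flatten hs e₀ e₀ (nil_zero (μ := Unit)) (nil_zero (μ := Unit))
      (by rw [hfl]; exact hC) (by rw [hfl]; exact hC) (Matrix.of fun _ _ => w)
    have hw' : flatten e₀ e₀ (Matrix.of fun _ _ => w) = pair 0 (w.map Prod.snd) := by
      ext a b
      · exact sndProj_eq_self_iff.1 hw a b
      · rfl
    rw [hfl, hw'] at h
    have h' : atBlocks (pair X₀ Y₀) F (Unit ⊕ Unit)
        (Matrix.fromBlocks 0 (Matrix.of fun _ _ => w) 0 0) (Sum.inl ()) (Sum.inr ()) =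
        A (w.map Prod.snd) := h.symm
    rw [h']
    simp only [lam, LinearMap.comp_apply, LinearEquiv.coe_coe, LinearEquiv.symm_apply_apply]
    ext a b
    · exact (sndProj_eq_self_iff.1 hw a b).symm
    · rfl

/-- `Δ_R^Y F` is bijective not only at the center but at any two matrices nilpotent about it. -/
theorem bijective_deltaR_snd (hs : 1 ≤ s) (hF : IsNCFunctionOn R (Nilp R (pair X₀ Y₀)) F)
    (hF₀ : F s (pair X₀ Y₀) = 0)
    (hinv : Function.Bijective (deltaRY R (Nilp R (pair X₀ Y₀)) F X₀ Y₀))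
    {A : Matrix (Fin n) (Fin n) (M × N)} {B : Matrix (Fin m) (Fin m) (M × N)}
    (hA : A ∈ Nilp R (pair X₀ Y₀) n) (hB : B ∈ Nilp R (pair X₀ Y₀) m) :
    Function.Bijective fun D : Matrix (Fin n) (Fin m) N =>
      deltaR R (Nilp R (pair X₀ Y₀)) F A B (pair 0 D) := by
  obtain ⟨lam, hinj, hrange, h₀, h₁⟩ := exists_normalization hs hF hF₀ hinv
  obtain ⟨a, ha, P, -, hP, rfl⟩ := mem_nilp_iff.1 hA
  obtain ⟨b, hb, Q, -, hQ, rfl⟩ := mem_nilp_iff.1 hB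
  set e := finProdFinEquiv.trans (finCongr ha)
  set e' := finProdFinEquiv.trans (finCongr hb)
  have hpair : ∀ D : Matrix (Fin a) (Fin b) (Matrix (Fin s) (Fin s) (M × N)),
      (∀ i j, sndProj R M N s (D i j) = D i j) ↔ ∃ d : Matrix (Fin n) (Fin m) N,
        pair (0 : Matrix (Fin n) (Fin m) M) d = flatten e e' D := by
    intro D
    constructor
    · intro h
      refine ⟨(flatten e e' D).map Prod.snd, ?_⟩
      ext x y
      · exact (sndProj_eq_self_iff.1 (h _ _) _ _).symm
      · rfl
    · rintro ⟨d, h⟩ i j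
      refine sndProj_eq_self_iff.2 fun x y => ?_
      rw [← flatten_apply e e' D, ← h]
      rfl
  rw [Function.bijective_iff_existsUnique]
  intro H
  obtain ⟨H, rfl⟩ := (flatten_bijective e e').2 H
  obtain ⟨D, ⟨hD, hDH⟩, huniq⟩ := ((hF.intertwines_atBlocks hs).map lam).existsUnique_upperRight
    (e := sndProj R M N s) (fun w => sndProj_eq_self_iff.2 fun _ _ => rfl)
    (fun μ _ _ p i j => hrange _) h₀ h₁ hP hQ (H.map lam) (fun i j => hrange _)
  have key : ∀ D : Matrix (Fin a) (Fin b) (Matrix (Fin s) (Fin s) (M × N)),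
      deltaR R (Nilp R (pair X₀ Y₀)) F (flatten e e (Matrix.diagonal (fun _ => pair X₀ Y₀) + P))
        (flatten e' e' (Matrix.diagonal (fun _ => pair X₀ Y₀) + Q)) (flatten e e' D) =
        flatten e e' H ↔ ∀ i j, lam (atBlocks (pair X₀ Y₀) F (Fin a ⊕ Fin b)
          (Matrix.fromBlocks P D 0 Q) (Sum.inl i) (Sum.inr j)) = lam (H i j) := by
    intro D
    rw [hF.deltaR_flatten hs e e' hP hQ hA hB, (flatten_bijective e e').1.eq_iff,
      ← Matrix.ext_iff]
    exact forall₂_congr fun i j => hinj.eq_iff.symm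
  obtain ⟨d, hd⟩ := (hpair D).1 hD
  refine ⟨d, ?_, fun d' hd' => ?_⟩
  · simp only [hd]
    exact (key D).2 hDH
  · obtain ⟨D', hD'⟩ := (flatten_bijective e e').2 (pair (0 : Matrix (Fin n) (Fin m) M) d')
    simp only [← hD'] at hd'
    have h := huniq D' ⟨(hpair D').2 ⟨d', hD'.symm⟩, (key D').1 hd'⟩
    rw [h, ← hd] at hD'
    ext x y
    exact (congrArg Prod.snd (congrFun (congrFun hD' x) y)).symm

/-- Over every matrix nilpotent about `X₀` there is a zero of `F`. -/
theorem exists_zero_snd (hs : 1 ≤ s) (hF : IsNCFunctionOn R (Nilp R (pair X₀ Y₀)) F)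
    (hF₀ : F s (pair X₀ Y₀) = 0)
    (hinv : Function.Bijective (deltaRY R (Nilp R (pair X₀ Y₀)) F X₀ Y₀))
    {X : Matrix (Fin n) (Fin n) M} (hX : X ∈ Nilp R X₀ n) :
    ∃ Y : Matrix (Fin n) (Fin n) N, pair X Y ∈ Nilp R (pair X₀ Y₀) n ∧ F n (pair X Y) = 0 := by
  obtain ⟨lam, hinj, hrange, h₀, h₁⟩ := exists_normalization hs hF hF₀ hinv
  obtain ⟨m, h, p, hm, hp, rfl⟩ := mem_nilp_iff.1 hX
  set e := finProdFinEquiv.trans (finCongr h)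
  obtain ⟨q, hq, hnil, hzero⟩ := ((hF.intertwines_atBlocks hs).map lam).exists_implicit
    (e := sndProj R M N s) (fun w => sndProj_eq_self_iff.2 fun _ _ => rfl)
    (fun μ _ _ p i j => hrange _) h₀ h₁ (hp.map (LinearMap.inl R M N).mapMatrix)
  have hXY : pair (flatten e e (Matrix.diagonal (fun _ => X₀) + p))
      ((flatten e e (Matrix.diagonal (fun _ => pair X₀ Y₀) + q)).map Prod.snd) =
      flatten e e (Matrix.diagonal (fun _ => pair X₀ Y₀) +
        (p.map (LinearMap.inl R M N).mapMatrix + q)) := by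
    have hq' := fun i j => sndProj_eq_self_iff.1 (hq i j)
    ext x y
    · simp [pair, flatten, diagonal_const_apply, hq', apply_ite Prod.fst]
    · simp [pair, flatten, diagonal_const_apply, apply_ite Prod.snd]
  have hmem : flatten e e (Matrix.diagonal (fun _ => pair X₀ Y₀) +
      (p.map (LinearMap.inl R M N).mapMatrix + q)) ∈ Nilp R (pair X₀ Y₀) n :=
    mem_nilp_iff.2 ⟨m, h, _, hm, hnil, rfl⟩
  refine ⟨_, by rw [hXY]; exact hmem, ?_⟩
  rw [hXY, hF.flatten_eq_atBlocks hs e hnil hmem]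
  have hz : atBlocks (pair X₀ Y₀) F (Fin m) (p.map (LinearMap.inl R M N).mapMatrix + q) = 0 := by
    ext1 i j
    refine hinj ?_
    rw [Matrix.zero_apply, map_zero]
    exact congrFun (congrFun hzero i) j
  rw [hz]
  rfl

theorem pair_blockUpper (X : Matrix (Fin n) (Fin n) M) (Z : Matrix (Fin n) (Fin m) M)
    (X' : Matrix (Fin m) (Fin m) M) (Y : Matrix (Fin n) (Fin n) N) (D : Matrix (Fin n) (Fin m) N)
    (Y' : Matrix (Fin m) (Fin m) N) : pair (blockUpper X Z X') (blockUpper Y D Y') =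
      blockUpper (pair X Y) (pair Z D) (pair X' Y') := by
  refine Matrix.ext fun x y => ?_
  refine Fin.addCases (fun x => ?_) (fun x => ?_) x <;>
    refine Fin.addCases (fun y => ?_) (fun y => ?_) y <;> simp [pair, blockUpper]

/-- Solutions `Y`, `Y'` of `F = 0` over `X`, `X'` inherit the intertwinings of `X` and `X'`. -/
theorem intertwine_of_zero (hs : 1 ≤ s) (hF : IsNCFunctionOn R (Nilp R (pair X₀ Y₀)) F)
    (hF₀ : F s (pair X₀ Y₀) = 0)
    (hinv : Function.Bijective (deltaRY R (Nilp R (pair X₀ Y₀)) F X₀ Y₀))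
    {X : Matrix (Fin n) (Fin n) M} {Y : Matrix (Fin n) (Fin n) N}
    {X' : Matrix (Fin m) (Fin m) M} {Y' : Matrix (Fin m) (Fin m) N}
    (h : pair X Y ∈ Nilp R (pair X₀ Y₀) n) (h' : pair X' Y' ∈ Nilp R (pair X₀ Y₀) m)
    (hz : F n (pair X Y) = 0) (hz' : F m (pair X' Y') = 0) (T : Matrix (Fin n) (Fin m) R)
    (hT : rmul X T = lmul T X') : rmul Y T = lmul T Y' := by
  -- Conjugation by `[1, T; 0, 1]` turns the zero `(X, Y) ⊕ (X', Y')` of `F` into a matrix whose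
  -- upper right block is `(0, T Y' - Y T)`.
  have hc : conj (upperUnit T) (directSum (pair X Y) (pair X' Y')) =
      blockUpper (pair X Y) (pair 0 (lmul T Y' - rmul Y T)) (pair X' Y') := by
    rw [conj_upperUnit_directSum]
    congr 1
    ext i j
    · have hT' := congrFun (congrFun hT i) j
      simp only [rmul, lmul, Matrix.of_apply] at hT'
      simp [lmul, rmul, pair, Prod.fst_sum, hT']
    · simp [lmul, rmul, pair, Prod.snd_sum]
  have hmem := blockUpper_mem_nilp (pair X₀ Y₀) (pair X Y) (pair X' Y')
    (pair 0 (lmul T Y' - rmul Y T)) h h'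
  have hd := hF.map_conj (directSum (pair X Y) (pair X' Y')) (upperUnit T)
    (blockUpper_mem_nilp _ _ _ 0 h h') (by rw [hc]; exact hmem)
  rw [hc, hF.map_directSum _ _ h h', hz, hz', directSum_zero, conj_upperUnit_zero] at hd
  have hzero : (fun D : Matrix (Fin n) (Fin m) N =>
      deltaR R (Nilp R (pair X₀ Y₀)) F (pair X Y) (pair X' Y') (pair 0 D))
        (lmul T Y' - rmul Y T) = (fun D : Matrix (Fin n) (Fin m) N =>
      deltaR R (Nilp R (pair X₀ Y₀)) F (pair X Y) (pair X' Y') (pair 0 D)) 0 := by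
    have h0 : (pair 0 0 : Matrix (Fin n) (Fin m) (M × N)) = 0 := rfl
    simp only [hF.deltaR_nilp h h', hd, h0]
    have h1 := hF.map_directSum _ _ h h'
    rw [hz, hz', directSum_zero, directSum] at h1
    rw [h1]
  exact (sub_eq_zero.1 ((bijective_deltaR_snd hs hF hF₀ hinv h h').1 hzero)).symm

theorem eq_of_zero (hs : 1 ≤ s) (hF : IsNCFunctionOn R (Nilp R (pair X₀ Y₀)) F)
    (hF₀ : F s (pair X₀ Y₀) = 0)
    (hinv : Function.Bijective (deltaRY R (Nilp R (pair X₀ Y₀)) F X₀ Y₀))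
    {X : Matrix (Fin n) (Fin n) M} {Y Y' : Matrix (Fin n) (Fin n) N}
    (h : pair X Y ∈ Nilp R (pair X₀ Y₀) n) (h' : pair X Y' ∈ Nilp R (pair X₀ Y₀) n)
    (hz : F n (pair X Y) = 0) (hz' : F n (pair X Y') = 0) : Y = Y' := by
  have h1 := intertwine_of_zero hs hF hF₀ hinv h h' hz hz' 1 (by
    ext i j; simp [rmul, lmul, Matrix.one_apply, ite_smul])
  ext i j
  simpa [rmul, lmul, Matrix.one_apply, ite_smul] using congrFun (congrFun h1 i) j

end Implicit

end NCImplicit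

theorem mainTheorem2 {R M N O : Type*} [CommRing R] [AddCommGroup M] [Module R M]
    [AddCommGroup N] [Module R N] [AddCommGroup O] [Module R O]
    {s : ℕ} (hs : 1 ≤ s) (X₀ : Matrix (Fin s) (Fin s) M) (Y₀ : Matrix (Fin s) (Fin s) N)
    (F : GradedMap (M × N) O) (hF : IsNCFunctionOn R (Nilp R (pair X₀ Y₀)) F)
    (hF₀ : F s (pair X₀ Y₀) = 0)
    (hinv : Function.Bijective (deltaRY R (Nilp R (pair X₀ Y₀)) F X₀ Y₀)) :
    ∃ f : GradedMap M N,
      IsNCFunctionOn R (Nilp R X₀) f ∧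
      (∀ (n : ℕ) (X : Matrix (Fin n) (Fin n) M), X ∈ Nilp R X₀ n → f n X ∈ Nilp R Y₀ n) ∧
      (∀ (n : ℕ) (X : Matrix (Fin n) (Fin n) M),
        X ∈ Nilp R X₀ n ↔ pair X (f n X) ∈ Nilp R (pair X₀ Y₀) n) ∧
      (∀ (n : ℕ) (X : Matrix (Fin n) (Fin n) M) (Y : Matrix (Fin n) (Fin n) N),
        pair X Y ∈ Nilp R (pair X₀ Y₀) n → (F n (pair X Y) = 0 ↔ Y = f n X)) ∧
      (∀ g : GradedMap M N, IsNCFunctionOn R (Nilp R X₀) g →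
        (∀ (n : ℕ) (X : Matrix (Fin n) (Fin n) M) (Y : Matrix (Fin n) (Fin n) N),
          pair X Y ∈ Nilp R (pair X₀ Y₀) n → (F n (pair X Y) = 0 ↔ Y = g n X)) →
        ∀ (n : ℕ) (X : Matrix (Fin n) (Fin n) M), X ∈ Nilp R X₀ n → g n X = f n X) ∧
      (∀ (n : ℕ) (X : Matrix (Fin n) (Fin n) M), X ∈ Nilp R X₀ n →
        ∃ L : Matrix (Fin n) (Fin n) N ≃ₗ[R] Matrix (Fin n) (Fin n) O,
          (∀ W : Matrix (Fin n) (Fin n) N,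
            L W = deltaRY R (Nilp R (pair X₀ Y₀)) F X (f n X) W) ∧
          ∀ Z : Matrix (Fin n) (Fin n) M,
            deltaR R (Nilp R X₀) f X X Z =
              -L.symm (deltaRX R (Nilp R (pair X₀ Y₀)) F X (f n X) Z)) := by
  classical
  set C := pair X₀ Y₀ with hC
  have hex : ∀ (n : ℕ) (X : Matrix (Fin n) (Fin n) M), ∃ Y : Matrix (Fin n) (Fin n) N,
      X ∈ Nilp R X₀ n → pair X Y ∈ Nilp R C n ∧ F n (pair X Y) = 0 := by
    intro n X
    by_cases hX : X ∈ Nilp R X₀ n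
    · obtain ⟨Y, hY⟩ := exists_zero_snd hs hF hF₀ hinv hX
      exact ⟨Y, fun _ => hY⟩
    · exact ⟨0, fun h => absurd h hX⟩
  choose f hf using hex
  have hmem : ∀ {n : ℕ} {X : Matrix (Fin n) (Fin n) M}, X ∈ Nilp R X₀ n →
      pair X (f n X) ∈ Nilp R C n := fun hX => (hf _ _ hX).1
  have hzero : ∀ {n : ℕ} {X : Matrix (Fin n) (Fin n) M}, X ∈ Nilp R X₀ n →
      F n (pair X (f n X)) = 0 := fun hX => (hf _ _ hX).2
  have huniq : ∀ {n : ℕ} {X : Matrix (Fin n) (Fin n) M} {Y : Matrix (Fin n) (Fin n) N},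
      pair X Y ∈ Nilp R C n → F n (pair X Y) = 0 → Y = f n X := fun h hz =>
    eq_of_zero hs hF hF₀ hinv h (hmem (fst_mem_nilp h)) hz (hzero (fst_mem_nilp h))
  have hnc : IsNCFunctionOn R (Nilp R X₀) f := by
    refine ⟨fun {n m} X X' hX hX' => ?_, fun {n} X S hX hSX => ?_⟩
    · have hp : pair (directSum X X') (directSum (f n X) (f m X')) =
          directSum (pair X (f n X)) (pair X' (f m X')) := pair_blockUpper _ _ _ _ _ _
      refine (huniq ?_ ?_).symm
      · rw [hp]
        exact (isNCSet_nilp hs C).directSum_mem _ _ (hmem hX) (hmem hX')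
      · rw [hp, hF.map_directSum _ _ (hmem hX) (hmem hX'), hzero hX, hzero hX', directSum_zero]
    · have h := intertwine_of_zero hs hF hF₀ hinv (hmem hSX) (hmem hX) (hzero hSX) (hzero hX)
        (S : Matrix (Fin n) (Fin n) R) (conj_rmul S X)
      exact (eq_conj_iff_rmul_eq S _ _).2 h
  have hpu : ∀ {n : ℕ} (X Z : Matrix (Fin n) (Fin n) M) (D : Matrix (Fin n) (Fin n) N),
      pair (blockUpper X Z X) (blockUpper (f n X) D (f n X)) =
        blockUpper (pair X (f n X)) (pair Z D) (pair X (f n X)) := fun X Z D =>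
    pair_blockUpper _ _ _ _ _ _
  refine ⟨f, hnc, fun n X hX => snd_mem_nilp (hmem hX), fun n X => ⟨hmem, fst_mem_nilp⟩,
    fun n X Y h => ⟨huniq h, fun hY => ?_⟩, fun g _ hg n X hX => ?_, fun n X hX => ?_⟩
  · rw [hY]
    exact hzero (fst_mem_nilp h)
  · exact ((hg n X (f n X) (hmem hX)).1 (hzero hX)).symm
  · have hP := hmem hX
    let L : Matrix (Fin n) (Fin n) N →ₗ[R] Matrix (Fin n) (Fin n) O :=
      { toFun := deltaRY R (Nilp R C) F X (f n X)
        map_add' := fun Z Z' => by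
          rw [deltaRY, deltaRY, deltaRY, ← hF.deltaR_add hs hP hP]
          congr 1
          ext <;> simp [pair]
        map_smul' := fun r Z => by
          rw [deltaRY, deltaRY, RingHom.id_apply, ← hF.deltaR_smul hs hP hP]
          congr 1
          ext <;> simp [pair] }
    let L' := LinearEquiv.ofBijective L (bijective_deltaR_snd hs hF hF₀ hinv hP hP)
    refine ⟨L', fun W => rfl, fun Z => ?_⟩
    -- `[f X, D; 0, f X]` is the solution over `[X, Z; 0, X]`, as `Δ_R F` vanishes at `(Z, D)`.
    let D := -L'.symm (deltaRX R (Nilp R C) F X (f n X) Z)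
    have hsum : deltaR R (Nilp R C) F (pair X (f n X)) (pair X (f n X)) (pair Z D) = 0 := by
      have hZD : pair Z D = pair Z 0 + pair 0 D := by ext <;> simp [pair]
      have hD : deltaR R (Nilp R C) F (pair X (f n X)) (pair X (f n X)) (pair 0 D) = L' D := rfl
      rw [hZD, hF.deltaR_add hs hP hP, hD, map_neg, LinearEquiv.apply_symm_apply]
      exact add_neg_cancel _
    have hU := blockUpper_mem_nilp C _ _ (pair Z D) hP hP
    have hval : f (n + n) (blockUpper X Z X) = blockUpper (f n X) D (f n X) := by
      refine (huniq ?_ ?_).symm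
      · rw [hpu]
        exact hU
      · rw [hF.deltaR_nilp hP hP] at hsum
        rw [hpu, hF.map_blockUpper (isNCSet_nilp hs C) hP hP hU, hsum, hzero hX]
        exact directSum_zero
    rw [hnc.deltaR_nilp hX hX, hval, block12_blockUpper]
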